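/- **Replacement Lemma.** Let $\mathbb T_N=\mathbb Z/N\mathbb Z$ and $\mathbb T=\mathbb R/\mathbb Z$. The facilitated exclusion process on $\{0,1\}^{\mathbb T_N}$ has generator $$\mathcal L_Nf(\eta)=\sum_{x\in\mathbb T_N}c_{x,x+1}(\eta)\big(f(\eta^{x,x+1})-f(\eta)\big),\qquad c_{x,x+1}(\eta)=\eta(x-1)\eta(x)(1-\eta(x+1))+\eta(x+2)\eta(x+1)(1-\eta(x)),$$ where $\eta^{x,y}$ is obtained from $\eta$ by exchanging the states of the sites $x$ and $y$. For a probability measure $\nu$ on $\{0,1\}^{\mathbb T_N}$ let $\mathbb P_\nu$, with expectation $\mathbb E_\nu$, be the law of the càdlàg Markov process $(\eta_t)_{t\ge 0}$ with generator $N^2\mathcal L_N$ and initial distribution $\nu$. Fix a smooth profile $\rho_0:\mathbb T\to(\tfrac12,1]$, let $\mu_N$ be the product measure $$\mu_N(\eta)=\prod_{k\in\mathbb T_N}\Big(\rho_0(\tfrac kN)\eta(k)+\big(1-\rho_0(\tfrac kN)\big)(1-\eta(k))\Big),$$ and let $\mathcal E_N$ be the set of ergodic configurations, i.e. of all $\eta$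 with $(\eta(x),\eta(x+1))\ne(0,0)$ for every $x\in\mathbb T_N$ and $\sum_{x}\eta(x)>N/2$. Put $t_N=(\log N)^{32}/N^2$ and $\tau_N=\inf\{t>0:\eta_t\in\mathcal E_N\}$, and let $$\widetilde\mu_N(\eta')=\mathbb P_{\mu_N}\big(\eta_{t_N}=\eta'\,\big|\,\tau_N\le t_N\big).$$ With the translations $(\tau_x\eta)(y)=\eta(x+y)$ and the boxes $B_k=\{-k,\dots,k\}$, let $$h(\eta)=\eta(-1)\eta(0)+\eta(0)\eta(1)-\eta(-1)\eta(0)\eta(1),\qquad F(\rho)=\max\Big\{0,\frac{2\rho-1}{\rho}\Big\}\quad(F(0)=0),$$ $$V_k(h,\eta)=\frac1{2k+1}\sum_{y\in B_k}h(\tau_y\eta)-F\Big(\frac1{2k+1}\sum_{y\in B_k}\eta(y)\Big).$$ Then, for every $T>0$, $$\limsup_{\varepsilon\downarrow0}\ \limsup_{N\to\infty}\ \mathbb E_{\widetilde\mu_N}\bigg[\int_0^T\frac1N\sum_{x\in\mathbb T_N}\big|V_{\lfloor\varepsilon N\rfloor}(h,\tau_x\eta_s)\big|\,ds\bigg]=0.$$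 -/

import Mathlib

open MeasureTheory ProbabilityTheory Filter Topology
open scoped ENNReal NNReal BigOperators

namespace FEP

/-- Particle configurations on the discrete torus `ℤ/Nℤ`; `true` means that the site is occupied. -/
abbrev Config (N : ℕ) : Type := ZMod N → Bool

/-- The occupation variable `η(x) ∈ {0,1}`, as a real number. -/
def occ {N : ℕ} (η : Config N) (x : ZMod N) : ℝ := if η x then 1 else 0

/-- The translation `(τ_x η)(y) = η(x + y)`. -/
def shift {N : ℕ} (x : ZMod N) (η : Config N) : Config N := fun y => η (x + y)

/-- The configuration `η^{x,y}`, in which the states of the sites `x` and `y` are exchanged. -/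
def exchange {N : ℕ} (η : Config N) (x y : ZMod N) : Config N := fun z => η (Equiv.swap x y z)

/-- The rate `c_{x,x+1}(η)` of the exchange over the edge `(x,x+1)`. -/
noncomputable def rate {N : ℕ} (η : Config N) (x : ZMod N) : ℝ :=
  occ η (x - 1) * occ η x * (1 - occ η (x + 1)) + occ η (x + 2) * occ η (x + 1) * (1 - occ η x)

/-- The generator of the facilitated exclusion process,
`(L_N f)(η) = ∑_x c_{x,x+1}(η) (f(η^{x,x+1}) - f(η))`. -/
noncomputable def generator {N : ℕ} [NeZero N] (f : Config N → ℝ) (η : Config N) : ℝ :=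
  ∑ x : ZMod N, rate η x * (f (exchange η x (x + 1)) - f η)

/-- The matrix of `L_N`: its entry at `(η, η')` is `(L_N 𝟙_{η'})(η)`. -/
noncomputable def generatorMatrix (N : ℕ) [NeZero N] : Matrix (Config N) (Config N) ℝ :=
  Matrix.of fun η η' => generator (Pi.single η' 1) η

/-- The transition matrices `exp(t N² L_N)` of the process accelerated by `N²`. -/
noncomputable def transition (N : ℕ) [NeZero N] (t : ℝ) : Matrix (Config N) (Config N) ℝ :=
  NormedSpace.exp ((t * (N : ℝ) ^ 2) • generatorMatrix N)

/-- `(η_t)_{t ≥ 0}`, under the laws `Pr a` of the process started from the configuration `a`, is the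
càdlàg Markov process with generator `N² L_N`. Paths are càdlàg for the discrete topology of the
finite state space, and the finite-dimensional distributions are those of the transition
matrices `exp(t N² L_N)`. -/
structure IsProcess {N : ℕ} [NeZero N] {Ω : Type*} [MeasurableSpace Ω]
    (Pr : Config N → Measure Ω) (η : ℝ≥0 → Ω → Config N) : Prop where
  isProbabilityMeasure : ∀ a, IsProbabilityMeasure (Pr a)
  measurable : ∀ t, Measurable (η t)
  right_continuous : ∀ ω t, ∀ᶠ s in 𝓝[>] t, η s ω = η t ω
  left_limits : ∀ ω t, ∃ b, ∀ᶠ s in 𝓝[<] t, η s ω = b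
  finite_dimensional : ∀ (n : ℕ) (t : ℕ → ℝ≥0), Monotone t → t 0 = 0 → ∀ a : ℕ → Config N,
    Pr (a 0) {ω | ∀ i ≤ n, η (t i) ω = a i} =
      ENNReal.ofReal (∏ i ∈ Finset.range n, transition N ((t (i + 1) : ℝ) - t i) (a i) (a (i + 1)))

/-- The law `P_ν = ∑_a ν(a) P_a` of the process with initial distribution `ν`. -/
noncomputable def startedFrom {N : ℕ} [NeZero N] {Ω : Type*} [MeasurableSpace Ω]
    (Pr : Config N → Measure Ω) (ν : Measure (Config N)) : Measure Ω :=
  ∑ a : Config N, ν {a} • Pr a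

/-- The ergodic configurations: no two neighbouring sites are empty, and there are more than
`N / 2` particles. -/
def ergodic (N : ℕ) [NeZero N] : Set (Config N) :=
  {η | (∀ x : ZMod N, ¬ (η x = false ∧ η (x + 1) = false)) ∧ (N : ℝ) / 2 < ∑ x : ZMod N, occ η x}

/-- The product measure `μ_N(η) = ∏_k (ρ₀(k/N) η(k) + (1 - ρ₀(k/N)) (1 - η(k)))`, where `ρ₀` is
a `1`-periodic function. -/
noncomputable def initialMeasure (ρ₀ : ℝ → ℝ) (N : ℕ) [NeZero N] : Measure (Config N) :=
  ∑ η : Config N, ENNReal.ofReal (∏ k : ZMod N,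
    (ρ₀ ((k.val : ℝ) / N) * occ η k + (1 - ρ₀ ((k.val : ℝ) / N)) * (1 - occ η k))) •
      Measure.dirac η

/-- The time `t_N = ℓ_N ^ 4 / N ^ 2` with `ℓ_N = (log N) ^ 8`. -/
noncomputable def transienceTime (N : ℕ) : ℝ≥0 :=
  ⟨((Real.log N) ^ 8) ^ 4 / (N : ℝ) ^ 2, by positivity⟩

/-- The hitting time `inf {t > 0 | η_t ∈ E_N}` of the ergodic component, `∞` if it is not hit. -/
noncomputable def hittingTime {N : ℕ} [NeZero N] {Ω : Type*} (η : ℝ≥0 → Ω → Config N) (ω : Ω) :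
    ℝ≥0∞ :=
  ⨅ t ∈ {t : ℝ≥0 | 0 < t ∧ η t ω ∈ ergodic N}, (t : ℝ≥0∞)

/-- The distribution `μ̃_N` at time `t_N` of the process started from `μ_N`, conditioned on having
hit the ergodic component by time `t_N`. -/
noncomputable def conditionedMeasure {N : ℕ} [NeZero N] {Ω : Type*} [MeasurableSpace Ω]
    (ρ₀ : ℝ → ℝ) (Pr : Config N → Measure Ω) (η : ℝ≥0 → Ω → Config N) : Measure (Config N) :=
  (cond (startedFrom Pr (initialMeasure ρ₀ N))
    {ω | hittingTime η ω ≤ (transienceTime N : ℝ≥0∞)}).map (η (transienceTime N))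

/-- The local function `h(η) = η(-1)η(0) + η(0)η(1) - η(-1)η(0)η(1)`. -/
noncomputable def h {N : ℕ} (η : Config N) : ℝ :=
  occ η (-1) * occ η 0 + occ η 0 * occ η 1 - occ η (-1) * occ η 0 * occ η 1

/-- The function `F(ρ) = max {0, (2ρ - 1) / ρ}` (equal to `0` at `ρ = 0`). -/
noncomputable def F (ρ : ℝ) : ℝ := max 0 ((2 * ρ - 1) / ρ)

/-- The average of `g(y)` over the box `B_k = {-k, …, k}`. -/
noncomputable def boxAverage {N : ℕ} (k : ℕ) (g : ZMod N → ℝ) : ℝ :=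
  1 / (2 * (k : ℝ) + 1) * ∑ y ∈ Finset.Icc (-(k : ℤ)) k, g (y : ZMod N)

/-- `V_k(h, η) = (2k+1)⁻¹ ∑_{y ∈ B_k} τ_y h(η) - F(ρ^k(0)(η))`, where `ρ^k(0)(η)` is the empirical
density of `η` in `B_k`. -/
noncomputable def V {N : ℕ} (k : ℕ) (η : Config N) : ℝ :=
  boxAverage k (fun y => h (shift y η)) - F (boxAverage k (fun y => occ η y))

end FEP

/-! From a configuration without two neighbouring holes no jump creates such a pair. Once the
ergodic component has been visited, the process therefore stays among the `Isolated` configurations,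
so the conditioned measure has mass at most one and is carried by them. It suffices to bound the
process started from one isolated configuration, uniformly in that configuration.

Seen from a particle, an isolated configuration is a word of gaps 0 or 1, and a jump exchanges two
unequal consecutive gaps: the gaps perform a symmetric exclusion. A particle has h = 1 unless the
gaps on both its sides equal 1. In a box of n sites starting at a particle and containing m
particles, F of the density is 2 - n/m. Up to O(1/n), the defect `V` thus compares the density of
consecutive pairs of gaps with the square of the density of gaps, which is what `gapForm` measures
(`abs_boxDefect_le`).

Of the n⁴ terms in the square of `gapForm`, all but O(n³) vanish or are antisymmetric under the
exchange of two gaps (`quadTerm_swap`). The mean of an antisymmetric term is at most the cost of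
that exchange, which is n times the ℓ¹ variation of the density along jumps. Since a given jump
serves at most one root (`sum_hop_le`), summing over the roots costs no factor N.

On isolated configurations the jumps are reversible for the counting measure. The entropy drops by
at most O(N), while its production carries the factor N²; by Cauchy-Schwarz the time integral of
`bondVariation` is bounded uniformly in N (`integral_bondVariation_le`). For n close to 2εN the
estimates combine to a bound of order rn/N + 1/r + r/n, and r = ε^(-1/2) makes it O(√ε). The
argument works directly at the macroscopic scale, with no passage through an intermediate block
size. -/

namespace FEP

/-! ### Isolated configurations as sequences of gaps, and jumps as exchanges of gaps. -/

section

/-- The length minus one of the step from a particle at `d` to the next one, for a sequence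
without two neighbouring holes. -/
def gapAt (e : ℕ → Bool) (d : ℕ) : ℕ := if e (d + 1) then 0 else 1

/-- The position of the `i`-th particle, counted from a particle at the origin. -/
def disp (e : ℕ → Bool) : ℕ → ℕ
  | 0 => 0
  | i + 1 => disp e i + 1 + gapAt e (disp e i)

/-- The number of holes (zero or one) behind the `i`-th particle. -/
def gap (e : ℕ → Bool) (i : ℕ) : ℕ := gapAt e (disp e i)

theorem disp_succ (e : ℕ → Bool) (i : ℕ) : disp e (i + 1) = disp e i + 1 + gap e i := rfl

theorem gap_le_one (e : ℕ → Bool) (i : ℕ) : gap e i ≤ 1 := by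
  unfold gap gapAt; split <;> simp

theorem disp_eq_sum (e : ℕ → Bool) (i : ℕ) :
    disp e i = i + ∑ l ∈ Finset.range i, gap e l := by
  induction i with
  | zero => simp [disp]
  | succ i ih => rw [disp_succ, Finset.sum_range_succ, ih]; omega

theorem disp_le (e : ℕ → Bool) (i : ℕ) : disp e i ≤ 2 * i := by
  induction i with
  | zero => simp [disp]
  | succ i ih => have := gap_le_one e i; rw [disp_succ]; omega

theorem disp_strictMono (e : ℕ → Bool) : StrictMono (disp e) :=
  strictMono_nat_of_lt_succ fun i => by rw [disp_succ]; omega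

theorem le_disp (e : ℕ → Bool) (i : ℕ) : i ≤ disp e i := (disp_strictMono e).le_apply

theorem apply_disp {e : ℕ → Bool} (he : ∀ d, e d = true ∨ e (d + 1) = true) (h0 : e 0 = true)
    (i : ℕ) : e (disp e i) = true := by
  induction i with
  | zero => simpa [disp]
  | succ i ih =>
    rw [disp_succ, gap, gapAt]
    split_ifs with h
    · simpa using h
    · rcases he (disp e i + 1) with h' | h'
      · exact absurd h' h
      · simpa using h'

section Swap

variable {e e' : ℕ → Bool} {M i : ℕ}

theorem disp_eq_of_eq_below (h : ∀ d ≤ disp e i, e' d = e d) {l : ℕ} (hl : l ≤ i) :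
    disp e' l = disp e l := by
  induction l with
  | zero => rfl
  | succ l ih =>
    have h1 : disp e (l + 1) ≤ disp e i := (disp_strictMono e).monotone hl
    have h2 := ih (by omega)
    rw [disp_succ] at h1
    rw [disp_succ, disp_succ, gap, gap, gapAt, gapAt, h2, h _ (by omega)]

/-- The local pattern is 1101 or 1011, with gaps (0,1) or (1,0). Exchanging its middle sites
exchanges these gaps and leaves particle `i + 2` at `disp e i + 3`, so nothing beyond it moves. The
bounds by `M` keep every inspected site within one turn of the torus. -/
theorem gap_swap (hne : e (disp e i + 1) ≠ e (disp e i + 2)) (h3 : e (disp e i + 3) = true)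
    (hout : ∀ d < M, d ≠ disp e i + 1 → d ≠ disp e i + 2 → e' d = e d)
    (h1 : e' (disp e i + 1) = e (disp e i + 2)) (h2 : e' (disp e i + 2) = e (disp e i + 1))
    (hi : 2 * i + 3 < M) {l : ℕ} (hl : 2 * l + 1 < M) :
    gap e' l = gap e (Equiv.swap i (i + 1) l) := by
  have hDi := disp_le e i
  have hlow : ∀ l ≤ i, disp e' l = disp e l := fun l hl =>
    disp_eq_of_eq_below (fun d hd => hout d (by omega) (by omega) (by omega)) hl
  have h3' : e' (disp e i + 3) = true := by rw [hout _ (by omega) (by omega) (by omega), h3]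
  have key : gap e' i = gap e (i + 1) ∧ gap e' (i + 1) = gap e i ∧
      disp e (i + 2) = disp e i + 3 ∧ disp e' (i + 2) = disp e i + 3 := by
    simp only [disp_succ, gap, gapAt, hlow i le_rfl, h1]
    rcases Bool.eq_false_or_eq_true (e (disp e i + 1)) with ha | ha <;>
      rcases Bool.eq_false_or_eq_true (e (disp e i + 2)) with hb | hb <;>
      simp_all [add_assoc]
  obtain ⟨k1, k2, k3, k4⟩ := key
  have hhigh : ∀ l, 2 * (i + 2 + l) + 1 < M + 2 → disp e' (i + 2 + l) = disp e (i + 2 + l) := by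
    intro l
    induction l with
    | zero => intro _; simp [k3, k4]
    | succ l ih =>
      intro hl
      have h4 := ih (by omega)
      have h5 := disp_le e (i + 2 + l)
      have h6 : disp e (i + 2) ≤ disp e (i + 2 + l) := (disp_strictMono e).monotone (by omega)
      rw [← add_assoc (i + 2) l 1, disp_succ, disp_succ, gap, gap, gapAt, gapAt, h4,
        hout _ (by omega) (by omega) (by omega)]
  rcases lt_trichotomy l i with hli | rfl | hli
  · rw [Equiv.swap_apply_of_ne_of_ne (by omega) (by omega), gap, gap, gapAt, gapAt,
      hlow l hli.le]
    have : disp e l + 1 ≤ disp e i := (disp_strictMono e) hli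
    rw [hout _ (by omega) (by omega) (by omega)]
  · rw [Equiv.swap_apply_left, k1]
  · rcases eq_or_ne l (i + 1) with rfl | hne'
    · rw [Equiv.swap_apply_right, k2]
    · obtain ⟨l, rfl⟩ : ∃ j, l = i + 2 + j := ⟨l - (i + 2), by omega⟩
      rw [Equiv.swap_apply_of_ne_of_ne (by omega) (by omega), gap, gap, gapAt, gapAt,
        hhigh l (by omega)]
      have h5 := disp_le e (i + 2 + l)
      have h6 : disp e (i + 2) ≤ disp e (i + 2 + l) := (disp_strictMono e).monotone (by omega)
      rw [hout _ (by omega) (by omega) (by omega)]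

/-- Without neighbouring holes, the patterns excluded by `h` are 111 and 1010, whose two gaps agree:
where no exchange is possible, none is needed. -/
theorem gap_eq_gap_succ (he : ∀ d, e d = true ∨ e (d + 1) = true)
    (h : ¬ (e (disp e i + 1) ≠ e (disp e i + 2) ∧ e (disp e i + 3) = true)) :
    gap e i = gap e (i + 1) := by
  have := he (disp e i + 1)
  have := he (disp e i + 2)
  simp only [disp_succ, gap, gapAt]
  rcases Bool.eq_false_or_eq_true (e (disp e i + 1)) with ha | ha <;>
    rcases Bool.eq_false_or_eq_true (e (disp e i + 2)) with hb | hb <;>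
    simp_all [add_assoc]

end Swap

variable {N : ℕ}

/-- No two neighbouring sites are empty. -/
def Isolated (η : Config N) : Prop := ∀ x : ZMod N, η x = true ∨ η (x + 1) = true

/-- The configuration seen to the right of `x`. -/
def view (η : Config N) (x : ZMod N) : ℕ → Bool := fun d => η (x + (d : ZMod N))

theorem Isolated.view {η : Config N} (hη : Isolated η) (x : ZMod N) (d : ℕ) :
    view η x d = true ∨ view η x (d + 1) = true := by
  have := hη (x + d)
  simpa [FEP.view, add_assoc] using this

theorem add_natCast_inj {x : ZMod N} {a b : ℕ} (ha : a < N) (hb : b < N) :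
    x + (a : ZMod N) = x + (b : ZMod N) ↔ a = b := by
  rw [add_right_inj, ZMod.natCast_eq_natCast_iff', Nat.mod_eq_of_lt ha, Nat.mod_eq_of_lt hb]

theorem view_exchange {η : Config N} {x : ZMod N} {p d : ℕ} (hp : p + 1 < N) (hd : d < N) :
    view (exchange η (x + (p : ZMod N)) (x + (p : ZMod N) + 1)) x d =
      view η x (Equiv.swap p (p + 1) d) := by
  have h1 : x + (p : ZMod N) + 1 = x + ((p + 1 : ℕ) : ZMod N) := by push_cast; ring
  simp only [view, exchange, h1]
  congr 1
  rcases eq_or_ne d p with rfl | h2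
  · simp
  rcases eq_or_ne d (p + 1) with rfl | h3
  · simp
  rw [Equiv.swap_apply_of_ne_of_ne h2 h3, Equiv.swap_apply_of_ne_of_ne]
  · rwa [Ne, add_natCast_inj hd (by omega)]
  · rwa [Ne, add_natCast_inj hd hp]

theorem exchange_exchange (η : Config N) (x y : ZMod N) : exchange (exchange η x y) x y = η := by
  funext z; simp [exchange]

/-- Exchanging the two middle sites of `1101` or `1011` creates no pair of holes. -/
theorem Isolated.exchange {η : Config N} (hN : 4 ≤ N) (hη : Isolated η) {z : ZMod N}
    (h0 : η (z - 1) = true) (hne : η z ≠ η (z + 1)) (h3 : η (z + 2) = true) :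
    Isolated (exchange η z (z + 1)) := by
  have hc : ∀ a b : ℕ, a < N → b < N → a ≠ b → z - 1 + (a : ZMod N) ≠ z - 1 + (b : ZMod N) :=
    fun a b ha hb hab h => hab ((add_natCast_inj ha hb).1 h)
  have c01 := hc 0 1 (by omega) (by omega) (by omega)
  have c02 := hc 0 2 (by omega) (by omega) (by omega)
  have c31 := hc 3 1 (by omega) (by omega) (by omega)
  have c32 := hc 3 2 (by omega) (by omega) (by omega)
  have e1 : z - 1 + ((1 : ℕ) : ZMod N) = z := by push_cast; ring
  have e2 : z - 1 + ((2 : ℕ) : ZMod N) = z + 1 := by push_cast; ring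
  have e3 : z - 1 + ((3 : ℕ) : ZMod N) = z + 2 := by push_cast; ring
  have e0 : z - 1 + ((0 : ℕ) : ZMod N) = z - 1 := by push_cast; ring
  rw [e0, e1] at c01
  rw [e0, e2] at c02
  rw [e3, e1] at c31
  rw [e3, e2] at c32
  intro w
  unfold FEP.exchange
  rcases eq_or_ne w z with rfl | h1
  · simp only [Equiv.swap_apply_left, Equiv.swap_apply_right]
    exact (hη w).symm
  rcases eq_or_ne w (z + 1) with rfl | h2
  · right
    have : z + 1 + 1 = z + 2 := by ring
    rw [this, Equiv.swap_apply_of_ne_of_ne c31 c32, h3]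
  rcases eq_or_ne w (z - 1) with rfl | h4
  · left; rw [Equiv.swap_apply_of_ne_of_ne c01 c02, h0]
  rw [Equiv.swap_apply_of_ne_of_ne h1 h2, Equiv.swap_apply_of_ne_of_ne]
  · exact hη w
  · intro h; exact h4 (by rw [← h]; ring)
  · intro h; exact h1 (add_right_cancel h)

open Classical in
/-- Exchange of the gaps behind the particles number `i` and `i + 1`, counted from `x`. -/
noncomputable def hop (x : ZMod N) (i : ℕ) (η : Config N) : Config N :=
  if Isolated η ∧ η x = true ∧
      view η x (disp (view η x) i + 1) ≠ view η x (disp (view η x) i + 2) ∧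
      view η x (disp (view η x) i + 3) = true
  then exchange η (x + ((disp (view η x) i + 1 : ℕ) : ZMod N))
    (x + ((disp (view η x) i + 1 : ℕ) : ZMod N) + 1)
  else η

theorem Isolated.hop {x : ZMod N} {i : ℕ} {η : Config N} (hN : 2 * i + 4 ≤ N) (hη : Isolated η) :
    Isolated (hop x i η) := by
  unfold FEP.hop
  split_ifs with h
  · obtain ⟨-, h0, h1, h2⟩ := h
    refine hη.exchange (by omega) ?_ ?_ ?_
    · have := apply_disp (hη.view x) (by simpa [FEP.view] using h0) i
      have e : x + ((disp (FEP.view η x) i + 1 : ℕ) : ZMod N) - 1 =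
          x + ((disp (FEP.view η x) i : ℕ) : ZMod N) := by push_cast; ring
      rw [e]; exact this
    · simpa [FEP.view, add_assoc, one_add_one_eq_two] using h1
    · have e3 : (1 + 2 : ZMod N) = 3 := by norm_num
      simpa [FEP.view, add_assoc, e3] using h2
  · exact hη

theorem hop_apply_root {x : ZMod N} {i : ℕ} {η : Config N} (hN : 2 * i + 4 ≤ N) :
    hop x i η x = η x := by
  unfold FEP.hop
  split_ifs with h
  · have hD := disp_le (FEP.view η x) i
    have := view_exchange (η := η) (x := x) (p := disp (view η x) i + 1) (d := 0)
      (by omega) (by omega)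
    rw [Equiv.swap_apply_of_ne_of_ne (by omega) (by omega)] at this
    simpa [FEP.view] using this
  · rfl

theorem hop_view_facts {x : ZMod N} {i : ℕ} {η : Config N} (hN : 2 * i + 4 ≤ N)
    (h : Isolated η ∧ η x = true ∧
      view η x (disp (view η x) i + 1) ≠ view η x (disp (view η x) i + 2) ∧
      view η x (disp (view η x) i + 3) = true) :
    (∀ d < N, d ≠ disp (view η x) i + 1 → d ≠ disp (view η x) i + 2 →
      view (hop x i η) x d = view η x d) ∧
    view (hop x i η) x (disp (view η x) i + 1) = view η x (disp (view η x) i + 2) ∧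
    view (hop x i η) x (disp (view η x) i + 2) = view η x (disp (view η x) i + 1) := by
  have hD := disp_le (FEP.view η x) i
  rw [FEP.hop, if_pos h]
  refine ⟨fun d hd h1 h2 => ?_, ?_, ?_⟩
  · rw [view_exchange (by omega) hd, Equiv.swap_apply_of_ne_of_ne h1 h2]
  · rw [view_exchange (by omega) (by omega), Equiv.swap_apply_left]
  · rw [view_exchange (by omega) (by omega), Equiv.swap_apply_right]

theorem gap_hop {x : ZMod N} {i l : ℕ} {η : Config N} (hi : 2 * i + 4 ≤ N) (hl : 2 * l + 1 < N)
    (hη : Isolated η) (hx : η x = true) :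
    gap (view (hop x i η) x) l = gap (view η x) (Equiv.swap i (i + 1) l) := by
  by_cases h : Isolated η ∧ η x = true ∧
      view η x (disp (view η x) i + 1) ≠ view η x (disp (view η x) i + 2) ∧
      view η x (disp (view η x) i + 3) = true
  · obtain ⟨h1, h2, h3⟩ := hop_view_facts hi h
    exact gap_swap h.2.2.1 h.2.2.2 h1 h2 h3 (by omega) hl
  · rw [FEP.hop, if_neg h]
    have := gap_eq_gap_succ (i := i) (hη.view x) (fun h' => h ⟨hη, hx, h'⟩)
    rcases eq_or_ne l i with rfl | h2
    · rw [Equiv.swap_apply_left, this]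
    rcases eq_or_ne l (i + 1) with rfl | h3
    · rw [Equiv.swap_apply_right, this]
    rw [Equiv.swap_apply_of_ne_of_ne h2 h3]

/-- The exchange alters only sites beyond particle `i`, so this particle is found at the same place
afterwards, and the condition for exchanging is symmetric in the two sites. -/
theorem hop_hop {x : ZMod N} {i : ℕ} (hN : 2 * i + 4 ≤ N) (η : Config N) :
    hop x i (hop x i η) = η := by
  by_cases h : Isolated η ∧ η x = true ∧
      view η x (disp (view η x) i + 1) ≠ view η x (disp (view η x) i + 2) ∧
      view η x (disp (view η x) i + 3) = true
  · obtain ⟨h1, h2, h3⟩ := hop_view_facts hN h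
    have hD := disp_le (FEP.view η x) i
    have hdisp : disp (view (hop x i η) x) i = disp (view η x) i :=
      disp_eq_of_eq_below (fun d hd => h1 d (by omega) (by omega) (by omega)) le_rfl
    have h' : Isolated (hop x i η) ∧ hop x i η x = true ∧
        view (hop x i η) x (disp (view (hop x i η) x) i + 1) ≠
          view (hop x i η) x (disp (view (hop x i η) x) i + 2) ∧
        view (hop x i η) x (disp (view (hop x i η) x) i + 3) = true := by
      rw [hdisp, h2, h3, h1 _ (by omega) (by omega) (by omega)]
      exact ⟨h.1.hop hN, by rw [hop_apply_root hN]; exact h.2.1, h.2.2.1.symm, h.2.2.2⟩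
    rw [FEP.hop, if_pos h', hdisp]
    conv_lhs => rw [FEP.hop, if_pos h]
    rw [exchange_exchange]
  · have : hop x i η = η := by rw [FEP.hop, if_neg h]
    rw [this, this]

/-- A particle determines the particle preceding it, so its `i`-th predecessor is determined as
well. -/
theorem add_disp_injOn {η : Config N} (hη : Isolated η) (i : ℕ) :
    Set.InjOn (fun x : ZMod N => x + ((disp (view η x) i : ℕ) : ZMod N)) {x | η x = true} := by
  induction i with
  | zero => intro x _ y _ h; simpa [disp] using h
  | succ i ih =>
    intro x hx y hy h
    refine ih hx hy ?_
    have hx' := apply_disp (hη.view x) (by simpa [FEP.view] using hx) i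
    have hy' := apply_disp (hη.view y) (by simpa [FEP.view] using hy) i
    simp only [disp_succ, gap, gapAt] at h
    simp only [FEP.view] at hx' hy'
    have ex : view η x (disp (view η x) i + 1) =
        η (x + ((disp (view η x) i : ℕ) : ZMod N) + 1) := by simp [FEP.view, add_assoc]
    have ey : view η y (disp (view η y) i + 1) =
        η (y + ((disp (view η y) i : ℕ) : ZMod N) + 1) := by simp [FEP.view, add_assoc]
    rw [ex, ey] at h
    push_cast at h
    simp only [← add_assoc] at h
    change η (x + ((disp (view η x) i : ℕ) : ZMod N)) = true at hx'
    change η (y + ((disp (view η y) i : ℕ) : ZMod N)) = true at hy'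
    change x + ((disp (view η x) i : ℕ) : ZMod N) = y + ((disp (view η y) i : ℕ) : ZMod N)
    generalize x + ((disp (view η x) i : ℕ) : ZMod N) = a at *
    generalize y + ((disp (view η y) i : ℕ) : ZMod N) = b at *
    split_ifs at h with h1 h2 h2
    · simpa using h
    · exfalso
      have : a = b + 1 := by simpa using h
      rw [this] at hx'; exact h2 hx'
    · exfalso
      have : a + 1 = b := by simpa using h
      rw [← this] at hy'; exact h1 hy'
    · simpa using h

/-- The `ℓ¹` norm of the increments of `f` along the jumps between configurations without
neighbouring holes. -/
noncomputable def bondVariation [NeZero N] (f : Config N → ℝ) : ℝ :=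
  open Classical in
  ∑ η : Config N with Isolated η, ∑ x : ZMod N, rate η x * |f (exchange η x (x + 1)) - f η|

theorem occ_nonneg (η : Config N) (x : ZMod N) : 0 ≤ occ η x := by
  unfold occ; split_ifs <;> norm_num

theorem occ_le_one (η : Config N) (x : ZMod N) : occ η x ≤ 1 := by
  unfold occ; split_ifs <;> norm_num

theorem rate_nonneg (η : Config N) (x : ZMod N) : 0 ≤ rate η x := by
  have h0 := occ_nonneg η
  have h1 : ∀ y, 0 ≤ 1 - occ η y := fun y => by linarith [occ_le_one η y]
  exact add_nonneg (mul_nonneg (mul_nonneg (h0 _) (h0 _)) (h1 _))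
    (mul_nonneg (mul_nonneg (h0 _) (h0 _)) (h1 _))

theorem bondVariation_nonneg [NeZero N] (f : Config N → ℝ) : 0 ≤ bondVariation f :=
  Finset.sum_nonneg fun _ _ => Finset.sum_nonneg fun _ _ =>
    mul_nonneg (rate_nonneg _ _) (abs_nonneg _)

/-- For fixed `i`, distinct roots give distinct `i`-th particles, so each bond is used by at most
one root. This is why the sum over all roots costs one `bondVariation` and not N of them. -/
theorem sum_hop_le [NeZero N] (f : Config N → ℝ) (i : ℕ) :
    (open Classical in ∑ x : ZMod N, ∑ η : Config N with Isolated η ∧ η x = true,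
      |f (hop x i η) - f η|) ≤ bondVariation f := by
  classical
  simp only [Finset.sum_filter]
  rw [Finset.sum_comm, bondVariation, Finset.sum_filter]
  refine Finset.sum_le_sum fun η _ => ?_
  by_cases hη : Isolated η
  swap
  · simp [hη]
  simp only [hη, true_and, if_true]
  set φ : ZMod N → ℝ := fun y => rate η y * |f (exchange η y (y + 1)) - f η| with hφ
  have hφ0 : ∀ y, 0 ≤ φ y := fun y => mul_nonneg (rate_nonneg η y) (abs_nonneg _)
  rw [← Finset.sum_filter]
  calc ∑ x : ZMod N with η x = true, |f (hop x i η) - f η|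
      ≤ ∑ x : ZMod N with η x = true, φ (x + ((disp (view η x) i : ℕ) : ZMod N) + 1) := by
        refine Finset.sum_le_sum fun x hx => ?_
        have hx : η x = true := by simpa using hx
        by_cases h : Isolated η ∧ η x = true ∧
            view η x (disp (view η x) i + 1) ≠ view η x (disp (view η x) i + 2) ∧
            view η x (disp (view η x) i + 3) = true
        · rw [FEP.hop, if_pos h]
          have h0 := apply_disp (hη.view x) (by simpa [FEP.view] using hx) i
          obtain ⟨-, -, h1, h2⟩ := h
          -- Both outer sites are occupied and the inner ones differ, so exactly one of the two
          -- products in the rate is 1.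
          have hr : rate η (x + ((disp (view η x) i : ℕ) : ZMod N) + 1) = 1 := by
            set y := x + ((disp (view η x) i : ℕ) : ZMod N) with hy
            have e0 : view η x (disp (view η x) i) = η y := rfl
            have e1 : view η x (disp (view η x) i + 1) = η (y + 1) := by
              simp [FEP.view, hy, add_assoc]
            have e2 : view η x (disp (view η x) i + 2) = η (y + 1 + 1) := by
              simp [FEP.view, hy, add_assoc, one_add_one_eq_two]
            have e3' : (1 + 2 : ZMod N) = 3 := by norm_num
            have e3 : view η x (disp (view η x) i + 3) = η (y + 1 + 2) := by
              simp [FEP.view, hy, add_assoc, e3']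
            rw [e0] at h0
            rw [e1, e2] at h1
            rw [e3] at h2
            simp only [rate, occ, add_sub_cancel_right, h0, h2]
            rcases Bool.eq_false_or_eq_true (η (y + 1)) with ha | ha <;>
              rcases Bool.eq_false_or_eq_true (η (y + 1 + 1)) with hb | hb <;> simp_all
          simp only [hφ, hr, one_mul]
          push_cast
          rw [← add_assoc x]
        · rw [FEP.hop, if_neg h]; simpa using hφ0 _
    _ = ∑ y ∈ (Finset.univ.filter fun x : ZMod N => η x = true).image
          (fun x : ZMod N => x + ((disp (view η x) i : ℕ) : ZMod N)), φ (y + 1) := by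
        rw [Finset.sum_image]
        intro x hx y hy h
        exact add_disp_injOn hη i (by simpa using hx) (by simpa using hy) h
    _ ≤ ∑ y : ZMod N, φ (y + 1) :=
        Finset.sum_le_sum_of_subset_of_nonneg (Finset.subset_univ _) fun y _ _ => hφ0 _
    _ = ∑ y : ZMod N, φ y := Equiv.sum_comp (Equiv.addRight (1 : ZMod N)) φ

end

/-! ### Exchange of distant gaps and the second moment of `gapForm`. -/

section

variable {N : ℕ}

open Classical in
/-- The configurations without neighbouring holes that have a particle at `x`. -/
noncomputable def rooted [NeZero N] (x : ZMod N) : Finset (Config N) :=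
  Finset.univ.filter fun η => Isolated η ∧ η x = true

theorem mem_rooted [NeZero N] {x : ZMod N} {η : Config N} :
    η ∈ rooted x ↔ Isolated η ∧ η x = true := by
  simp [rooted]

theorem hop_mem_rooted [NeZero N] {x : ZMod N} {i : ℕ} (hN : 2 * i + 4 ≤ N) {η : Config N}
    (hη : η ∈ rooted x) : hop x i η ∈ rooted x := by
  rw [mem_rooted] at *
  exact ⟨hη.1.hop hN, by rw [hop_apply_root hN]; exact hη.2⟩

theorem sum_rooted_comp [NeZero N] {x : ZMod N} {σ : Config N → Config N}
    (hinv : ∀ η, σ (σ η) = η) (hmem : ∀ η ∈ rooted x, σ η ∈ rooted x) (g : Config N → ℝ) :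
    ∑ η ∈ rooted x, g (σ η) = ∑ η ∈ rooted x, g η :=
  Finset.sum_nbij' σ σ hmem hmem (fun η _ => hinv η) (fun η _ => hinv η) (fun _ _ => rfl)

/-- The gaps number `i` and `j` behind a particle can be exchanged at the cost of `2 |i - j|`
jumps. -/
theorem exists_transposition [NeZero N] {i j : ℕ} (hij : i < j) (hN : 2 * j + 4 ≤ N) :
    ∃ σ : ZMod N → Config N → Config N, (∀ x η, σ x (σ x η) = η) ∧
      (∀ x, ∀ η ∈ rooted x, σ x η ∈ rooted x ∧ ∀ l, 2 * l + 1 < N →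
        gap (view (σ x η) x) l = gap (view η x) (Equiv.swap i j l)) ∧
      ∀ f : Config N → ℝ, ∑ x : ZMod N, ∑ η ∈ rooted x, |f (σ x η) - f η| ≤
        2 * ((j : ℝ) - i) * bondVariation f := by
  have hop_sum : ∀ (i : ℕ) (f : Config N → ℝ),
      ∑ x : ZMod N, ∑ η ∈ rooted x, |f (hop x i η) - f η| ≤ bondVariation f :=
    fun i f => sum_hop_le f i
  induction j, hij using Nat.le_induction with
  | base =>
    refine ⟨fun x => hop x i, fun x => hop_hop (by omega), fun x η hη =>
      ⟨hop_mem_rooted (by omega) hη, fun l hl => gap_hop (by omega) hl (mem_rooted.1 hη).1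
        (mem_rooted.1 hη).2⟩, fun f => ?_⟩
    have h0 := bondVariation_nonneg f
    refine (hop_sum i f).trans ?_
    push_cast
    linarith
  | succ j hij ih =>
    obtain ⟨σ, h1, h2, h3⟩ := ih (by omega)
    have hj : 2 * j + 4 ≤ N := by omega
    -- The transposition (i, j+1) is the conjugate of (i, j) by (j, j+1); each step thus adds two
    -- hops to the cost.
    refine ⟨fun x η => hop x j (σ x (hop x j η)), fun x η => by
      simp only [hop_hop hj, h1], fun x η hη => ?_, fun f => ?_⟩
    · have m1 := hop_mem_rooted hj hη
      have m2 := (h2 x _ m1).1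
      refine ⟨hop_mem_rooted hj m2, fun l hl => ?_⟩
      have hb : ∀ {a b : ℕ}, 2 * a + 1 < N → a ≤ j → b ≤ j + 1 → a < b → ∀ l, 2 * l + 1 < N →
          2 * (Equiv.swap a b l) + 1 < N := by
        intro a b _ ha hb _ l hl
        rw [Equiv.swap_apply_def]; split_ifs <;> omega
      rw [gap_hop hj hl (mem_rooted.1 m2).1 (mem_rooted.1 m2).2,
        (h2 x _ m1).2 _ (hb (by omega) le_rfl le_rfl (by omega) _ hl),
        gap_hop hj (hb (by omega) (by omega) (by omega) (by omega) _
          (hb (by omega) le_rfl le_rfl (by omega) _ hl)) (mem_rooted.1 hη).1 (mem_rooted.1 hη).2]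
      congr 1
      have := Equiv.swap_mul_swap_mul_swap (x := i) (y := j) (z := j + 1) (by omega) (by omega)
      rw [Equiv.swap_comm (j + 1) i] at this
      rw [← this]
      rfl
    · have e1 : ∀ x : ZMod N, ∑ η ∈ rooted x,
          |f (hop x j (σ x (hop x j η))) - f (σ x (hop x j η))| =
            ∑ η ∈ rooted x, |f (hop x j η) - f η| := by
        intro x
        rw [sum_rooted_comp (σ := hop x j) (hop_hop hj) (fun η => hop_mem_rooted hj)
          (fun η => |f (hop x j (σ x η)) - f (σ x η)|),
          sum_rooted_comp (σ := σ x) (h1 x) (fun η hη => (h2 x η hη).1)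
          (fun η => |f (hop x j η) - f η|)]
      have e2 : ∀ x : ZMod N, ∑ η ∈ rooted x, |f (σ x (hop x j η)) - f (hop x j η)| =
            ∑ η ∈ rooted x, |f (σ x η) - f η| := fun x =>
        sum_rooted_comp (σ := hop x j) (hop_hop hj) (fun η => hop_mem_rooted hj)
          (fun η => |f (σ x η) - f η|)
      calc ∑ x : ZMod N, ∑ η ∈ rooted x, |f (hop x j (σ x (hop x j η))) - f η|
          ≤ ∑ x : ZMod N, ∑ η ∈ rooted x,
              (|f (hop x j (σ x (hop x j η))) - f (σ x (hop x j η))| +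
                |f (σ x (hop x j η)) - f (hop x j η)| + |f (hop x j η) - f η|) := by
            refine Finset.sum_le_sum fun x _ => Finset.sum_le_sum fun η _ => ?_
            exact (abs_sub_le _ (f (hop x j η)) _).trans
              (add_le_add (abs_sub_le _ _ _) le_rfl)
        _ = (∑ x : ZMod N, ∑ η ∈ rooted x, |f (hop x j η) - f η|) +
              (∑ x : ZMod N, ∑ η ∈ rooted x, |f (σ x η) - f η|) +
              ∑ x : ZMod N, ∑ η ∈ rooted x, |f (hop x j η) - f η| := by
            simp only [Finset.sum_add_distrib, e1, e2]
        _ ≤ bondVariation f + 2 * ((j : ℝ) - i) * bondVariation f + bondVariation f := by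
            gcongr
            · exact hop_sum j f
            · exact h3 f
            · exact hop_sum j f
        _ = 2 * (((j + 1 : ℕ) : ℝ) - i) * bondVariation f := by push_cast; ring

/-- The mean of a bounded family that is antisymmetric under an exchange of gaps. -/
theorem abs_sum_antisymm_le [NeZero N] {i j : ℕ} (hij : i ≠ j) {n : ℕ} (hi : i < n) (hj : j < n)
    (hN : 2 * n + 4 ≤ N)
    (f : Config N → ℝ) (Ψ : ZMod N → Config N → ℝ) (hΨ : ∀ x, ∀ η ∈ rooted x, |Ψ x η| ≤ 1)
    (hanti : ∀ x, ∀ η ∈ rooted x, ∀ η' ∈ rooted x,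
      (∀ l ≤ n + 1, gap (view η' x) l = gap (view η x) (Equiv.swap i j l)) → Ψ x η' = -Ψ x η) :
    |∑ x : ZMod N, ∑ η ∈ rooted x, f η * Ψ x η| ≤ n * bondVariation f := by
  wlog hlt : i < j generalizing i j
  · exact this hij.symm hj hi (fun x η hη η' hη' h =>
      hanti x η hη η' hη' (by rwa [Equiv.swap_comm])) (by omega)
  obtain ⟨σ, h1, h2, h3⟩ := exists_transposition (N := N) hlt (by omega)
  -- Averaging the sum with its image under the exchange transfers the antisymmetry of `Ψ` to an
  -- increment of `f`.
  have hx : ∀ x : ZMod N, ∑ η ∈ rooted x, f η * Ψ x η =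
      (1 / 2) * ∑ η ∈ rooted x, (f η - f (σ x η)) * Ψ x η := by
    intro x
    have h4 := sum_rooted_comp (h1 x) (fun η hη => (h2 x η hη).1) (fun η => f η * Ψ x η)
    have h5 : ∑ η ∈ rooted x, f (σ x η) * Ψ x (σ x η) =
        ∑ η ∈ rooted x, -(f (σ x η) * Ψ x η) := by
      refine Finset.sum_congr rfl fun η hη => ?_
      rw [hanti x η hη _ (h2 x η hη).1 (fun l hl => (h2 x η hη).2 l (by omega))]; ring
    simp only [sub_mul, Finset.sum_sub_distrib]
    rw [h5, Finset.sum_neg_distrib] at h4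
    linarith
  have h0 := bondVariation_nonneg f
  simp only [hx]
  calc |∑ x : ZMod N, (1 / 2) * ∑ η ∈ rooted x, (f η - f (σ x η)) * Ψ x η|
      ≤ ∑ x : ZMod N, (1 / 2) * ∑ η ∈ rooted x, |f (σ x η) - f η| := by
        refine (Finset.abs_sum_le_sum_abs _ _).trans (Finset.sum_le_sum fun x _ => ?_)
        rw [abs_mul, abs_of_pos (by norm_num : (0 : ℝ) < 1 / 2)]
        gcongr
        refine (Finset.abs_sum_le_sum_abs _ _).trans (Finset.sum_le_sum fun η hη => ?_)
        rw [abs_mul, abs_sub_comm]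
        exact mul_le_of_le_one_right (abs_nonneg _) (hΨ x η hη)
    _ ≤ (1 / 2) * (2 * ((j : ℝ) - i) * bondVariation f) := by
        rw [← Finset.mul_sum]; gcongr; exact h3 f
    _ ≤ n * bondVariation f := by
        have : (j : ℝ) - i ≤ n := by
          have : (j : ℝ) ≤ n := by exact_mod_cast hj.le
          have : (0 : ℝ) ≤ i := by positivity
          linarith
        nlinarith

/-- The indicator that the particle number `i + 2` lies in the box of `n` sites. -/
noncomputable def within (n : ℕ) (e : ℕ → Bool) (i : ℕ) : ℝ := if disp e (i + 2) < n then 1 else 0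

/-- The particles are ordered, so only the largest index matters. A product of cutoffs thus depends
on a single displacement, which makes it invariant in `quadTerm_swap`. -/
theorem within_mul_within (n : ℕ) (e : ℕ → Bool) (i j : ℕ) :
    within n e i * within n e j = within n e (max i j) := by
  have h : disp e (max i j + 2) = max (disp e (i + 2)) (disp e (j + 2)) := by
    rw [← (disp_strictMono e).monotone.map_max]; congr 1; omega
  unfold within
  rw [h]
  by_cases h1 : disp e (i + 2) < n <;> by_cases h2 : disp e (j + 2) < n <;> simp [h1, h2]

theorem within_nonneg (n : ℕ) (e : ℕ → Bool) (i : ℕ) : 0 ≤ within n e i := by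
  unfold within; split_ifs <;> norm_num

theorem within_le_one (n : ℕ) (e : ℕ → Bool) (i : ℕ) : within n e i ≤ 1 := by
  unfold within; split_ifs <;> norm_num

/-- The difference of `n²` times the squared density of gaps in the box and the density of
neighbouring pairs of gaps, as a double sum. -/
noncomputable def gapForm (n : ℕ) (e : ℕ → Bool) : ℝ :=
  ∑ i ∈ Finset.range n, ∑ j ∈ Finset.range n,
    within n e i * within n e j * (((gap e i : ℝ) - gap e j) * gap e (j + 1))

/-- A term of the square of `gapForm`. -/
noncomputable def quadTerm (n : ℕ) (e : ℕ → Bool) (i j a b : ℕ) : ℝ :=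
  within n e (max (max i j) (max a b)) * (((gap e i : ℝ) - gap e j) * gap e (j + 1) *
    (((gap e a : ℝ) - gap e b) * gap e (b + 1)))

theorem gapForm_sq (n : ℕ) (e : ℕ → Bool) :
    gapForm n e ^ 2 = ∑ i ∈ Finset.range n, ∑ j ∈ Finset.range n, ∑ a ∈ Finset.range n,
      ∑ b ∈ Finset.range n, quadTerm n e i j a b := by
  rw [sq, gapForm, Finset.sum_mul]
  refine Finset.sum_congr rfl fun i _ => ?_
  rw [Finset.sum_mul]
  refine Finset.sum_congr rfl fun j _ => ?_
  rw [Finset.mul_sum]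
  refine Finset.sum_congr rfl fun a _ => ?_
  rw [Finset.mul_sum]
  refine Finset.sum_congr rfl fun b _ => ?_
  rw [quadTerm, ← within_mul_within, ← within_mul_within, ← within_mul_within]
  ring

theorem abs_quadTerm_le (n : ℕ) (e : ℕ → Bool) (i j a b : ℕ) : |quadTerm n e i j a b| ≤ 1 := by
  have h : ∀ l, (0 : ℝ) ≤ gap e l ∧ (gap e l : ℝ) ≤ 1 := fun l =>
    ⟨by positivity, by exact_mod_cast gap_le_one e l⟩
  have h1 : ∀ i j, |((gap e i : ℝ) - gap e j) * gap e (j + 1)| ≤ 1 := by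
    intro i j
    rw [abs_mul]
    refine mul_le_one₀ ?_ (abs_nonneg _) ?_
    · rw [abs_le]; constructor <;> linarith [h i, h j]
    · rw [abs_of_nonneg (h _).1]; exact (h _).2
  rw [quadTerm, abs_mul, abs_mul, abs_of_nonneg (within_nonneg _ _ _)]
  exact mul_le_one₀ (within_le_one _ _ _) (by positivity)
    (mul_le_one₀ (h1 i j) (abs_nonneg _) (h1 a b))

/-- The cutoff is a function of the sum of all gaps up to an index beyond `i` and `j`, hence
symmetric. Only the factor `gap e i - gap e j` feels the exchange, provided no other index meets `i`
or `j`. -/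
theorem quadTerm_swap {n : ℕ} {e e' : ℕ → Bool} {i j a b : ℕ} (hi : i < n) (hj : j < n)
    (ha : a < n) (hb : b < n)
    (h1 : j + 1 ≠ i) (h2 : a ≠ i) (h3 : a ≠ j) (h4 : b ≠ i) (h5 : b ≠ j) (h6 : b + 1 ≠ i)
    (h7 : b + 1 ≠ j) (h : ∀ l ≤ n + 1, gap e' l = gap e (Equiv.swap i j l)) :
    quadTerm n e' i j a b = -quadTerm n e i j a b := by
  have hd : disp e' (max (max i j) (max a b) + 2) = disp e (max (max i j) (max a b) + 2) := by
    rw [disp_eq_sum, disp_eq_sum]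
    congr 1
    refine Finset.sum_equiv (Equiv.swap i j) (fun l => ?_) (fun l hl => ?_)
    · rw [Finset.mem_range, Finset.mem_range, Equiv.swap_apply_def]
      split_ifs <;> omega
    · exact h l (by rw [Finset.mem_range] at hl; omega)
  have hw : within n e' (max (max i j) (max a b)) = within n e (max (max i j) (max a b)) := by
    rw [within, within, hd]
  rw [quadTerm, quadTerm, hw, h i (by omega), h j (by omega), h (j + 1) (by omega),
    h a (by omega), h b (by omega), h (b + 1) (by omega), Equiv.swap_apply_left,
    Equiv.swap_apply_right, Equiv.swap_apply_of_ne_of_ne h1 (by omega),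
    Equiv.swap_apply_of_ne_of_ne h2 h3, Equiv.swap_apply_of_ne_of_ne h4 h5,
    Equiv.swap_apply_of_ne_of_ne h6 h7]
  ring

/-- The number of coincidences among the indices of a term of the square. -/
noncomputable def coincidences (i j a b : ℕ) : ℝ :=
  (if i = j + 1 then 1 else 0) + ((if a = i then 1 else 0) + (if a = j then 1 else 0)) +
    ((if b = i then 1 else 0) + (if b = j then 1 else 0) + (if b + 1 = i then 1 else 0) +
      (if b + 1 = j then 1 else 0))

theorem sum_ite_le_one (n : ℕ) (p : ℕ → Prop) [DecidablePred p]
    (hp : ∀ a b, p a → p b → a = b) :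
    ∑ b ∈ Finset.range n, (if p b then (1 : ℝ) else 0) ≤ 1 := by
  rw [← Finset.sum_filter, Finset.sum_const, nsmul_eq_mul, mul_one]
  exact_mod_cast Finset.card_le_one.2 fun a ha b hb =>
    hp a b (Finset.mem_filter.1 ha).2 (Finset.mem_filter.1 hb).2

/-- Each of the seven possible equalities removes one of the four free indices. -/
theorem sum_coincidences_le (n : ℕ) :
    ∑ i ∈ Finset.range n, ∑ j ∈ Finset.range n, ∑ a ∈ Finset.range n, ∑ b ∈ Finset.range n,
      coincidences i j a b ≤ 7 * (n : ℝ) ^ 3 := by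
  have hb : ∀ i j a, ∑ b ∈ Finset.range n, coincidences i j a b ≤
      n * ((if i = j + 1 then 1 else 0) + ((if a = i then 1 else 0) + (if a = j then 1 else 0)))
        + 4 := by
    intro i j a
    simp only [coincidences, Finset.sum_add_distrib, Finset.sum_const, Finset.card_range,
      nsmul_eq_mul]
    have h1 := sum_ite_le_one n (fun b => b = i) (by intros; omega)
    have h2 := sum_ite_le_one n (fun b => b = j) (by intros; omega)
    have h3 := sum_ite_le_one n (fun b => b + 1 = i) (by intros; omega)
    have h4 := sum_ite_le_one n (fun b => b + 1 = j) (by intros; omega)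
    linarith
  have ha : ∀ i j, ∑ a ∈ Finset.range n, ((n : ℝ) * ((if i = j + 1 then 1 else 0) +
      ((if a = i then 1 else 0) + (if a = j then 1 else 0))) + 4) ≤
      n ^ 2 * (if i = j + 1 then 1 else 0) + 6 * n := by
    intro i j
    simp only [Finset.sum_add_distrib, ← Finset.mul_sum, Finset.sum_const, Finset.card_range,
      nsmul_eq_mul]
    have h1 := sum_ite_le_one n (fun b => b = i) (by intros; omega)
    have h2 := sum_ite_le_one n (fun b => b = j) (by intros; omega)
    have hn : (0 : ℝ) ≤ n := by positivity
    nlinarith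
  have hj : ∀ i, ∑ j ∈ Finset.range n, ((n : ℝ) ^ 2 * (if i = j + 1 then (1 : ℝ) else 0) + 6 * (n : ℝ)) ≤
      7 * (n : ℝ) ^ 2 := by
    intro i
    simp only [Finset.sum_add_distrib, ← Finset.mul_sum, Finset.sum_const, Finset.card_range,
      nsmul_eq_mul]
    have h1 := sum_ite_le_one n (fun b => i = b + 1) (by intros; omega)
    have hn : (0 : ℝ) ≤ (n : ℝ) ^ 2 := by positivity
    nlinarith
  calc _ ≤ ∑ i ∈ Finset.range n, 7 * (n : ℝ) ^ 2 := by
        refine Finset.sum_le_sum fun i _ => le_trans ?_ (hj i)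
        refine Finset.sum_le_sum fun j _ => le_trans ?_ (ha i j)
        exact Finset.sum_le_sum fun a _ => hb i j a
    _ = 7 * (n : ℝ) ^ 3 := by rw [Finset.sum_const, Finset.card_range, nsmul_eq_mul]; ring

theorem sum_rooted_le [NeZero N] {f : Config N → ℝ} (hf : ∀ η, 0 ≤ f η)
    (hf1 : ∑ η, f η ≤ 1) : ∑ x : ZMod N, ∑ η ∈ rooted x, f η ≤ N := by
  calc ∑ x : ZMod N, ∑ η ∈ rooted x, f η ≤ ∑ x : ZMod N, (1 : ℝ) :=
        Finset.sum_le_sum fun x _ => (Finset.sum_le_sum_of_subset_of_nonneg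
          (Finset.subset_univ _) fun η _ _ => hf η).trans hf1
    _ = N := by simp [ZMod.card]

/-- Terms with `i = j` vanish, antisymmetric terms are paid by the exchange of two gaps, and the
remaining ones are bounded by 1 and counted by `coincidences`. -/
theorem sum_quadTerm_le [NeZero N] {n : ℕ} (hN : 2 * n + 4 ≤ N) {f : Config N → ℝ}
    (hf : ∀ η, 0 ≤ f η) (hf1 : ∑ η, f η ≤ 1) {i j a b : ℕ} (hi : i < n) (hj : j < n)
    (ha : a < n) (hb : b < n) :
    ∑ x : ZMod N, ∑ η ∈ rooted x, f η * quadTerm n (view η x) i j a b ≤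
      n * bondVariation f + N * coincidences i j a b := by
  have h0 := bondVariation_nonneg f
  rcases eq_or_ne i j with rfl | hij
  · have : ∀ e, quadTerm n e i i a b = 0 := fun e => by simp [quadTerm]
    simp only [this, mul_zero, Finset.sum_const_zero]
    have : 0 ≤ coincidences i i a b := by
      unfold coincidences; split_ifs <;> norm_num
    positivity
  by_cases hc : i = j + 1 ∨ a = i ∨ a = j ∨ b = i ∨ b = j ∨ b + 1 = i ∨ b + 1 = j
  · have h1 : 1 ≤ coincidences i j a b := by
      unfold coincidences
      rcases hc with h | h | h | h | h | h | h <;> simp only [h, if_true] <;> split_ifs <;> norm_num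
    have h2 : ∑ x : ZMod N, ∑ η ∈ rooted x, f η * quadTerm n (view η x) i j a b ≤ N := by
      refine le_trans (Finset.sum_le_sum fun x _ => Finset.sum_le_sum fun η _ => ?_)
        (sum_rooted_le hf hf1)
      exact mul_le_of_le_one_right (hf η) ((le_abs_self _).trans (abs_quadTerm_le _ _ _ _ _ _))
    have h3 : (N : ℝ) ≤ N * coincidences i j a b := le_mul_of_one_le_right (by positivity) h1
    have : 0 ≤ (n : ℝ) * bondVariation f := by positivity
    linarith
  · push Not at hc
    obtain ⟨c1, c2, c3, c4, c5, c6, c7⟩ := hc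
    have h1 := abs_sum_antisymm_le hij hi hj hN f
      (fun x η => quadTerm n (view η x) i j a b) (fun x η _ => abs_quadTerm_le _ _ _ _ _ _)
      (fun x η _ η' _ h => quadTerm_swap hi hj ha hb c1.symm c2 c3 c4 c5 c6 c7 h)
    have : 0 ≤ coincidences i j a b := by
      unfold coincidences; split_ifs <;> norm_num
    have : 0 ≤ (N : ℝ) * coincidences i j a b := by positivity
    linarith [(abs_le.1 h1).2]

/-- The second moment of `gapForm` around a typical particle. -/
theorem sum_gapForm_sq_le [NeZero N] {n : ℕ} (hN : 2 * n + 4 ≤ N) {f : Config N → ℝ}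
    (hf : ∀ η, 0 ≤ f η) (hf1 : ∑ η, f η ≤ 1) :
    ∑ x : ZMod N, ∑ η ∈ rooted x, f η * gapForm n (view η x) ^ 2 ≤
      n ^ 5 * bondVariation f + 7 * N * n ^ 3 := by
  have e : ∑ x : ZMod N, ∑ η ∈ rooted x, f η * gapForm n (view η x) ^ 2 =
      ∑ i ∈ Finset.range n, ∑ j ∈ Finset.range n, ∑ a ∈ Finset.range n, ∑ b ∈ Finset.range n,
        ∑ x : ZMod N, ∑ η ∈ rooted x, f η * quadTerm n (view η x) i j a b := by
    simp only [gapForm_sq, Finset.mul_sum]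
    simp only [Finset.sum_comm (s := rooted _)]
    simp only [Finset.sum_comm (s := (Finset.univ : Finset (ZMod N)))]
  rw [e]
  calc _ ≤ ∑ i ∈ Finset.range n, ∑ j ∈ Finset.range n, ∑ a ∈ Finset.range n,
        ∑ b ∈ Finset.range n, (n * bondVariation f + N * coincidences i j a b) := by
        refine Finset.sum_le_sum fun i hi => Finset.sum_le_sum fun j hj =>
          Finset.sum_le_sum fun a ha => Finset.sum_le_sum fun b hb => ?_
        rw [Finset.mem_range] at hi hj ha hb
        exact sum_quadTerm_le hN hf hf1 hi hj ha hb
    _ = n ^ 5 * bondVariation f + N * ∑ i ∈ Finset.range n, ∑ j ∈ Finset.range n,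
        ∑ a ∈ Finset.range n, ∑ b ∈ Finset.range n, coincidences i j a b := by
        simp only [Finset.sum_add_distrib, Finset.sum_const, Finset.card_range, nsmul_eq_mul,
          ← Finset.mul_sum]
        ring
    _ ≤ n ^ 5 * bondVariation f + N * (7 * (n : ℝ) ^ 3) := by
        gcongr; exact sum_coincidences_le n
    _ = _ := by ring

end

/-! ### The defect of a box in terms of its gaps, and the static estimate. -/

section

variable {N : ℕ}

/-- The function `h`, seen from the site `z`. -/
noncomputable def hAt (η : Config N) (z : ZMod N) : ℝ :=
  occ η (z - 1) * occ η z + occ η z * occ η (z + 1) - occ η (z - 1) * occ η z * occ η (z + 1)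

theorem hAt_nonneg (η : Config N) (z : ZMod N) : 0 ≤ hAt η z := by
  unfold hAt occ; split_ifs <;> norm_num

theorem hAt_le_one (η : Config N) (z : ZMod N) : hAt η z ≤ 1 := by
  unfold hAt occ; split_ifs <;> norm_num

/-- The local defect of `V`, for the box of `n` sites starting at `x`. -/
noncomputable def boxDefect (n : ℕ) (η : Config N) (x : ZMod N) : ℝ :=
  (∑ d ∈ Finset.range n, hAt η (x + (d : ZMod N))) / n -
    F ((∑ d ∈ Finset.range n, occ η (x + (d : ZMod N))) / n)

theorem sum_Icc_eq_sum_range (k : ℕ) (g : ℤ → ℝ) :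
    ∑ y ∈ Finset.Icc (-(k : ℤ)) k, g y = ∑ d ∈ Finset.range (2 * k + 1), g ((d : ℤ) - k) := by
  refine Finset.sum_nbij' (fun y => (y + k).toNat) (fun d => (d : ℤ) - k) ?_ ?_ ?_ ?_ ?_
  · intro y hy; simp only [Finset.mem_Icc, Finset.mem_range] at *; omega
  · intro d hd; simp only [Finset.mem_Icc, Finset.mem_range] at *; omega
  · intro y hy; simp only [Finset.mem_Icc] at *; omega
  · intro d hd; simp
  · intro y hy
    simp only [Finset.mem_Icc] at hy
    congr 1; omega

theorem V_shift (k : ℕ) (η : Config N) (z : ZMod N) :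
    V k (shift z η) = boxDefect (2 * k + 1) η (z - k) := by
  have h1 : ∀ d : ℕ, z - (k : ZMod N) + d = z + (((d : ℤ) - k : ℤ) : ZMod N) := by
    intro d; push_cast; ring
  unfold V boxAverage boxDefect
  rw [sum_Icc_eq_sum_range k (fun y => h (shift (y : ZMod N) (shift z η))),
    sum_Icc_eq_sum_range k (fun y => occ (shift z η) (y : ZMod N))]
  have h2 : ∀ y : ZMod N, h (shift y (shift z η)) = hAt η (z + y) := by
    intro y
    have a1 : occ (shift y (shift z η)) (-1) = occ η (z + y - 1) := by
      change occ η (z + (y + -1)) = _; congr 1; ring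
    have a2 : occ (shift y (shift z η)) 0 = occ η (z + y) := by
      change occ η (z + (y + 0)) = _; congr 1; ring
    have a3 : occ (shift y (shift z η)) 1 = occ η (z + y + 1) := by
      change occ η (z + (y + 1)) = _; congr 1; ring
    rw [h, hAt, a1, a2, a3]
  have h3 : ∀ y : ZMod N, occ (shift z η) y = occ η (z + y) := fun y => rfl
  simp only [h1, h2, h3]
  push_cast
  rw [one_div_mul_eq_div, one_div_mul_eq_div]

/-- Above 1/2 one has F(c) = 2 - 1/c, whose slope 1/c² is at most 4; below 1/2 the function
vanishes. -/
theorem F_lipschitz {a b : ℝ} (ha : 0 ≤ a) (hb : 0 ≤ b) : |F a - F b| ≤ 4 * |a - b| := by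
  wlog hab : a ≤ b generalizing a b
  · rw [abs_sub_comm, abs_sub_comm a]; exact this hb ha (by linarith)
  have hF : ∀ c, 0 ≤ c → c ≤ 1 / 2 → F c = 0 := fun c hc h =>
    max_eq_left (div_nonpos_of_nonpos_of_nonneg (by linarith) hc)
  have hF' : ∀ c, 1 / 2 ≤ c → F c = 2 - 1 / c := by
    intro c h
    have : 0 < c := by linarith
    have e : (2 * c - 1) / c = 2 - 1 / c := by field_simp
    rw [F, max_eq_right (div_nonneg (by linarith) this.le), e]
  have key : ∀ c d : ℝ, 1 / 2 ≤ c → c ≤ d → |(2 - 1 / c) - (2 - 1 / d)| ≤ 4 * (d - c) := by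
    intro c d hc hcd
    have h1 : 0 < c := by linarith
    have h2 : 0 < d := by linarith
    have e : (2 - 1 / c) - (2 - 1 / d) = -((d - c) / (c * d)) := by field_simp; ring
    rw [e, abs_neg, abs_of_nonneg (div_nonneg (by linarith) (by positivity)), div_le_iff₀
      (by positivity)]
    have : 1 / 4 ≤ c * d := by nlinarith
    nlinarith
  rw [abs_sub_comm a, abs_of_nonneg (by linarith : 0 ≤ b - a)]
  rcases le_total b (1 / 2) with h1 | h1
  · rw [hF a ha (by linarith), hF b hb h1]; simp; linarith
  · rcases le_total a (1 / 2) with h2 | h2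
    · have := key (1 / 2) b le_rfl h1
      rw [hF a ha h2, hF' b h1]
      have e : (2 : ℝ) - 1 / (1 / 2) = 0 := by norm_num
      rw [e] at this
      exact this.trans (by linarith)
    · rw [hF' a h2, hF' b h1]; exact key a b h2 hab

theorem sum_range_shift_sub (n : ℕ) (φ : ZMod N → ℝ) (x : ZMod N) :
    ∑ d ∈ Finset.range n, φ (x + 1 + (d : ZMod N)) - ∑ d ∈ Finset.range n, φ (x + (d : ZMod N)) =
      φ (x + (n : ZMod N)) - φ x := by
  induction n with
  | zero => simp
  | succ n ih =>
    rw [Finset.sum_range_succ, Finset.sum_range_succ]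
    have : x + 1 + (n : ZMod N) = x + ((n + 1 : ℕ) : ZMod N) := by push_cast; ring
    rw [this]; linarith

/-- Moving the box by one site changes each of the two sums by at most 1; hence 5 = 1 + 4, with 4
the Lipschitz constant of `F`. This allows a box starting at a hole to be replaced by the next one.
-/
theorem abs_boxDefect_le_succ {n : ℕ} (hn : 0 < n) (η : Config N) (x : ZMod N) :
    |boxDefect n η x| ≤ |boxDefect n η (x + 1)| + 5 / n := by
  have hn' : (0 : ℝ) < n := by exact_mod_cast hn
  have h1 := sum_range_shift_sub n (hAt η) x
  have h2 := sum_range_shift_sub n (occ η) x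
  set A := ∑ d ∈ Finset.range n, occ η (x + (d : ZMod N)) with hA
  set A' := ∑ d ∈ Finset.range n, occ η (x + 1 + (d : ZMod N)) with hA'
  set H := ∑ d ∈ Finset.range n, hAt η (x + (d : ZMod N)) with hH
  set H' := ∑ d ∈ Finset.range n, hAt η (x + 1 + (d : ZMod N)) with hH'
  have hA0 : 0 ≤ A := Finset.sum_nonneg fun _ _ => occ_nonneg _ _
  have hA0' : 0 ≤ A' := Finset.sum_nonneg fun _ _ => occ_nonneg _ _
  have hHd : |H / n - H' / n| ≤ 1 / n := by
    rw [← sub_div, abs_div, abs_of_pos hn']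
    gcongr
    rw [abs_le]
    constructor <;>
      linarith [hAt_nonneg η x, hAt_le_one η x, hAt_nonneg η (x + n), hAt_le_one η (x + n)]
  have hFd : |F (A / n) - F (A' / n)| ≤ 4 / n := by
    refine (F_lipschitz (by positivity) (by positivity)).trans ?_
    rw [← sub_div, abs_div, abs_of_pos hn', ← mul_div_assoc]
    gcongr
    have : |A - A'| ≤ 1 := by
      rw [abs_le]
      constructor <;>
        linarith [occ_nonneg η x, occ_le_one η x, occ_nonneg η (x + n), occ_le_one η (x + n)]
    linarith
  have e1 : boxDefect n η x = H / n - F (A / n) := rfl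
  have e2 : boxDefect n η (x + 1) = H' / n - F (A' / n) := rfl
  rw [e1, e2]
  have e3 : H / n - F (A / n) = (H' / n - F (A' / n)) + ((H / n - H' / n) -
      (F (A / n) - F (A' / n))) := by ring
  have e4 : (5 : ℝ) / n = 1 / n + 4 / n := by ring
  rw [e3, e4]
  refine (abs_add_le _ _).trans ?_
  gcongr
  exact (abs_sub _ _).trans (add_le_add hHd hFd)

section Root

variable {η : Config N} {x : ZMod N}

theorem occ_view (η : Config N) (x : ZMod N) (d : ℕ) :
    occ η (x + (d : ZMod N)) = if view η x d then 1 else 0 := rfl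

theorem occ_disp (hη : Isolated η) (hx : η x = true) (i : ℕ) :
    occ η (x + ((disp (view η x) i : ℕ) : ZMod N)) = 1 := by
  rw [occ_view, apply_disp (hη.view x) (by simpa [view] using hx) i]; simp

theorem occ_disp_succ (η : Config N) (x : ZMod N) (i : ℕ) :
    occ η (x + ((disp (view η x) i : ℕ) : ZMod N) + 1) = 1 - gap (view η x) i := by
  have : x + ((disp (view η x) i : ℕ) : ZMod N) + 1 =
      x + ((disp (view η x) i + 1 : ℕ) : ZMod N) := by push_cast; ring
  rw [this, occ_view, gap, gapAt]
  split_ifs <;> simp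

theorem occ_disp_pred (hη : Isolated η) (hx : η x = true) (i : ℕ) :
    occ η (x + ((disp (view η x) (i + 1) : ℕ) : ZMod N) - 1) = 1 - gap (view η x) i := by
  rw [disp_succ]
  have hg := gap_le_one (view η x) i
  rcases Nat.le_one_iff_eq_zero_or_eq_one.1 hg with h | h
  · have := occ_disp hη hx i
    rw [h]
    push_cast
    rw [add_zero, ← add_assoc, add_sub_cancel_right, this]; simp
  · have := occ_disp_succ η x i
    rw [h] at this ⊢
    push_cast
    rw [← add_assoc, ← add_assoc, add_sub_cancel_right, this]; simp

theorem hAt_disp_succ (hη : Isolated η) (hx : η x = true) (i : ℕ) :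
    hAt η (x + ((disp (view η x) (i + 1) : ℕ) : ZMod N)) =
      1 - gap (view η x) i * gap (view η x) (i + 1) := by
  rw [hAt, occ_disp_pred hη hx, occ_disp hη hx, occ_disp_succ]; ring

theorem sum_range_disp (φ : ZMod N → ℝ) (hφ : ∀ z, occ η z = 0 → φ z = 0) (l : ℕ) :
    ∑ d ∈ Finset.range (disp (view η x) l), φ (x + (d : ZMod N)) =
      ∑ i ∈ Finset.range l, φ (x + ((disp (view η x) i : ℕ) : ZMod N)) := by
  induction l with
  | zero => simp [disp]
  | succ l ih =>
    rw [Finset.sum_range_succ _ l, ← ih, disp_succ]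
    have hg := gap_le_one (view η x) l
    rcases Nat.le_one_iff_eq_zero_or_eq_one.1 hg with h | h
    · rw [h, add_zero, Finset.sum_range_succ]
    · rw [h, Finset.sum_range_succ, Finset.sum_range_succ]
      have h2 := occ_disp_succ η x l
      rw [h] at h2
      have : x + ((disp (view η x) l : ℕ) : ZMod N) + 1 =
        x + ((disp (view η x) l + 1 : ℕ) : ZMod N) := by push_cast; ring
      rw [this] at h2
      rw [hφ (x + ((disp (view η x) l + 1 : ℕ) : ZMod N)) (by rw [h2]; simp), add_zero]

theorem exists_disp_cover (e : ℕ → Bool) {n : ℕ} (hn : 0 < n) :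
    ∃ p, disp e p < n ∧ n ≤ disp e (p + 1) := by
  have hex : ∃ m, n ≤ disp e m := ⟨n, le_disp e n⟩
  classical
  have h0 : Nat.find hex ≠ 0 := by
    intro h
    have := Nat.find_spec hex
    rw [h] at this; simp [disp] at this; omega
  obtain ⟨p, hp⟩ := Nat.exists_eq_succ_of_ne_zero h0
  refine ⟨p, ?_, ?_⟩
  · have := Nat.find_min hex (m := p) (by omega)
    omega
  · have := Nat.find_spec hex
    rwa [hp] at this

theorem sum_range_eq_of_cover (φ : ZMod N → ℝ) (hφ : ∀ z, occ η z = 0 → φ z = 0) {n p : ℕ}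
    (h1 : disp (view η x) p < n) (h2 : n ≤ disp (view η x) (p + 1)) :
    ∑ d ∈ Finset.range n, φ (x + (d : ZMod N)) =
      ∑ i ∈ Finset.range (p + 1), φ (x + ((disp (view η x) i : ℕ) : ZMod N)) := by
  rw [Finset.sum_range_succ, ← sum_range_disp φ hφ, ← Finset.sum_range_succ]
  have h3 := h2
  rw [disp_succ] at h3
  have hg := gap_le_one (view η x) p
  rcases Nat.lt_or_ge (disp (view η x) p + 1) n with h | h
  · have hg1 : gap (view η x) p = 1 := by omega
    have hn : n = disp (view η x) p + 1 + 1 := by omega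
    rw [hn, Finset.sum_range_succ _ (disp (view η x) p + 1)]
    have h2 := occ_disp_succ η x p
    rw [hg1] at h2
    have : x + ((disp (view η x) p : ℕ) : ZMod N) + 1 =
      x + ((disp (view η x) p + 1 : ℕ) : ZMod N) := by push_cast; ring
    rw [this] at h2
    rw [hφ (x + ((disp (view η x) p + 1 : ℕ) : ZMod N)) (by rw [h2]; simp), add_zero]
  · have hn : n = disp (view η x) p + 1 := by omega
    rw [hn]

/-- Particle `p` is the last one in the box, so the cutoff at `i` says `i + 2 ≤ p`: it keeps the
pairs of gaps lying between particles of the box. -/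
theorem sum_within (e : ℕ → Bool) {n p : ℕ} (h1 : disp e p < n) (h2 : n ≤ disp e (p + 1))
    (hp : 1 ≤ p) (g : ℕ → ℝ) :
    ∑ i ∈ Finset.range n, within n e i * g i = ∑ i ∈ Finset.range (p - 1), g i := by
  have hpn : p ≤ n := (le_disp e p).trans h1.le
  have : ∀ i, within n e i = if i ∈ Finset.range (p - 1) then 1 else 0 := by
    intro i
    unfold within
    congr 1
    rw [Finset.mem_range, eq_iff_iff]
    constructor
    · intro h
      have := (disp_strictMono e).lt_iff_lt.1 (h.trans_le h2)
      omega
    · intro h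
      exact ((disp_strictMono e).monotone (by omega : i + 2 ≤ p)).trans_lt h1
  simp only [this, ite_mul, one_mul, zero_mul]
  rw [← Finset.sum_filter]
  congr 1
  ext i
  simp only [Finset.mem_filter, Finset.mem_range]
  omega

/-- The cutoffs factorize, which exhibits `gapForm` as a product of two gap counts minus the number
of admissible indices times the count of consecutive pairs of gaps. -/
theorem gapForm_eq (n : ℕ) (e : ℕ → Bool) : gapForm n e =
    (∑ i ∈ Finset.range n, within n e i * gap e i) *
      (∑ j ∈ Finset.range n, within n e j * gap e (j + 1)) -
    (∑ i ∈ Finset.range n, within n e i * 1) *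
      (∑ j ∈ Finset.range n, within n e j * (gap e j * gap e (j + 1))) := by
  rw [gapForm, Finset.sum_mul_sum, Finset.sum_mul_sum, ← Finset.sum_sub_distrib]
  refine Finset.sum_congr rfl fun i _ => ?_
  rw [← Finset.sum_sub_distrib]
  exact Finset.sum_congr rfl fun j _ => by ring

/-- Algebraic part of the comparison of the defect with `gapForm`; `m` is the number of particles
and `n` the length of the box. -/
theorem defect_algebra {n m B B₁ B₂ C r δ : ℝ} (hn : 0 < n) (hmn : n ≤ 2 * m) (hm : m ≤ n)
    (hB : n = m + B - δ) (hδ0 : 0 ≤ δ) (hδ1 : δ ≤ 1)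
    (h1 : B₁ ≤ B) (h1' : B ≤ B₁ + 2) (h2 : B₂ ≤ B) (h2' : B ≤ B₂ + 2)
    (hB2 : 0 ≤ B₂) (hB2n : B₂ ≤ n) (hC0 : 0 ≤ C) (hCn : C ≤ n) (hr0 : 0 ≤ r) (hr : r ≤ 2) :
    |(m - C - r) / n - (2 * m - n) / m| ≤
      2 * |B₁ * B₂ - (m - 2) * C| / n ^ 2 + 16 / n := by
  have hm0 : 0 < m := by linarith
  set G := B₁ * B₂ - (m - 2) * C with hG
  set W := (m - C - r) / n - (2 * m - n) / m with hW
  -- Apart from `G`, each of the four terms is at most 2n, since `n - m` differs from `B₁` and `B₂`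
  -- by at most 2. Dividing |G| + 8n by mn ≥ n²/2 gives the constants 2 and 16.
  have e1 : m * n * W = (n - m) * (n - m - B₂) + B₂ * (n - m - B₁) - 2 * C - m * r + G := by
    rw [hW, hG]; field_simp; ring
  have b1 : |(n - m) * (n - m - B₂)| ≤ n * 2 := by
    rw [abs_mul]
    refine mul_le_mul ?_ ?_ (abs_nonneg _) hn.le <;> rw [abs_le] <;> constructor <;> linarith
  have b2 : |B₂ * (n - m - B₁)| ≤ n * 2 := by
    rw [abs_mul]
    refine mul_le_mul ?_ ?_ (abs_nonneg _) hn.le <;> rw [abs_le] <;> constructor <;> linarith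
  have b3 : 0 ≤ m * r := by positivity
  have b4 : m * r ≤ n * 2 := mul_le_mul hm hr hr0 hn.le
  have hmain : |m * n * W| ≤ |G| + 8 * n := by
    rw [e1]
    have := abs_le.1 b1
    have := abs_le.1 b2
    have g1 := le_abs_self G
    have g2 := neg_abs_le G
    rw [abs_le]
    constructor <;> linarith
  rw [abs_mul, abs_of_pos (by positivity : 0 < m * n)] at hmain
  have e2 : 2 * |G| / n ^ 2 + 16 / n = (|G| + 8 * n) / (n / 2 * n) := by field_simp; ring
  rw [e2, le_div_iff₀ (by positivity)]
  refine le_trans ?_ hmain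
  rw [mul_comm]
  gcongr
  linarith

/-- Both averages are computed from the gaps. With m particles in the box, the sum of h is m minus
the number of consecutive pairs of gaps, up to boundary terms, and n is m plus the number of gaps,
up to an overhang of at most one site. -/
theorem abs_boxDefect_le (hη : Isolated η) (hx : η x = true) {n : ℕ} (hn : 3 ≤ n) :
    |boxDefect n η x| ≤ 2 * |gapForm n (view η x)| / (n : ℝ) ^ 2 + 16 / n := by
  obtain ⟨p, h1, h2⟩ := exists_disp_cover (view η x) (n := n) (by omega)
  have hp : 1 ≤ p := by
    by_contra h
    have h0 : p = 0 := by omega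
    subst h0
    have := disp_le (view η x) (0 + 1)
    omega
  set e := view η x with he
  have hA : ∑ d ∈ Finset.range n, occ η (x + (d : ZMod N)) = (p + 1 : ℕ) := by
    rw [sum_range_eq_of_cover (occ η) (fun z hz => hz) h1 h2]
    simp only [occ_disp hη hx]; simp
  have hH : ∑ d ∈ Finset.range n, hAt η (x + (d : ZMod N)) =
      hAt η x + (p - ∑ i ∈ Finset.range p, (gap e i * gap e (i + 1) : ℝ)) := by
    rw [sum_range_eq_of_cover (hAt η) (fun z hz => by simp [hAt, hz]) h1 h2,
      Finset.sum_range_succ']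
    simp only [hAt_disp_succ hη hx, Finset.sum_sub_distrib]
    simp [disp]; ring
  have hg : ∀ l, (0 : ℝ) ≤ gap e l ∧ (gap e l : ℝ) ≤ 1 := fun l =>
    ⟨by positivity, by exact_mod_cast gap_le_one e l⟩
  have hnp : p + 1 ≤ n := (le_disp e p).trans_lt h1
  have hnp2 : n ≤ 2 * (p + 1) := h2.trans (disp_le e (p + 1))
  -- A box starting at a particle is at least half full, so the truncation in `F` is inactive.
  have hF : F ((∑ d ∈ Finset.range n, occ η (x + (d : ZMod N))) / n) =
      (2 * ((p + 1 : ℕ) : ℝ) - n) / ((p + 1 : ℕ) : ℝ) := by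
    have hn0 : (0 : ℝ) < n := by exact_mod_cast (by omega : 0 < n)
    have hp0 : (0 : ℝ) < ((p + 1 : ℕ) : ℝ) := by positivity
    have : (n : ℝ) ≤ 2 * ((p + 1 : ℕ) : ℝ) := by exact_mod_cast hnp2
    rw [hA, F]
    have e1 : (2 * (((p + 1 : ℕ) : ℝ) / n) - 1) / (((p + 1 : ℕ) : ℝ) / n) =
        (2 * ((p + 1 : ℕ) : ℝ) - n) / ((p + 1 : ℕ) : ℝ) := by field_simp
    rw [e1, max_eq_right (div_nonneg (by linarith) hp0.le)]
  obtain ⟨q, rfl⟩ : ∃ q, p = q + 1 := ⟨p - 1, by omega⟩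
  have hD1 : n ≤ disp e (q + 1 + 1) := h2
  have hD2 : disp e (q + 1 + 1) ≤ n + 1 := by
    have := gap_le_one e (q + 1); rw [disp_succ]; omega
  have hDs : (disp e (q + 1 + 1) : ℝ) = (q + 1 + 1 : ℕ) +
      ∑ l ∈ Finset.range (q + 1 + 1), (gap e l : ℝ) := by
    rw [disp_eq_sum]; push_cast; ring
  have hGF : gapForm n e = (∑ i ∈ Finset.range q, (gap e i : ℝ)) *
      (∑ i ∈ Finset.range q, (gap e (i + 1) : ℝ)) -
      (((q + 1 + 1 : ℕ) : ℝ) - 2) * ∑ i ∈ Finset.range q, (gap e i * gap e (i + 1) : ℝ) := by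
    rw [gapForm_eq]
    simp only [sum_within e h1 h2 hp, Nat.add_sub_cancel]
    simp only [mul_one, Finset.sum_const, Finset.card_range, nsmul_eq_mul]
    push_cast
    ring
  rw [boxDefect, hF, hH, hGF]
  have hs1 : ∑ l ∈ Finset.range (q + 1 + 1), (gap e l : ℝ) =
      ∑ l ∈ Finset.range q, (gap e l : ℝ) + gap e q + gap e (q + 1) := by
    rw [Finset.sum_range_succ, Finset.sum_range_succ]
  have hs2 : ∑ l ∈ Finset.range (q + 1 + 1), (gap e l : ℝ) =
      ∑ l ∈ Finset.range q, (gap e (l + 1) : ℝ) + gap e 0 + gap e (q + 1) := by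
    rw [Finset.sum_range_succ, Finset.sum_range_succ']
  have hs3 := Finset.sum_range_succ (fun i => (gap e i * gap e (i + 1) : ℝ)) q
  have hB2 : 0 ≤ ∑ l ∈ Finset.range q, (gap e (l + 1) : ℝ) :=
    Finset.sum_nonneg fun l _ => (hg _).1
  have hB2' : ∑ l ∈ Finset.range q, (gap e (l + 1) : ℝ) ≤ q := by
    refine (Finset.sum_le_sum fun l _ => (hg (l + 1)).2).trans ?_; simp
  have hC : 0 ≤ ∑ i ∈ Finset.range q, (gap e i * gap e (i + 1) : ℝ) :=
    Finset.sum_nonneg fun l _ => mul_nonneg (hg _).1 (hg _).1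
  have hC' : ∑ i ∈ Finset.range q, (gap e i * gap e (i + 1) : ℝ) ≤ q := by
    refine (Finset.sum_le_sum fun l _ => mul_le_one₀ (hg l).2 (hg (l + 1)).1 (hg (l + 1)).2).trans
      ?_; simp
  have hqn : (q : ℝ) ≤ n := by exact_mod_cast (by omega : q ≤ n)
  have hD1' : (n : ℝ) ≤ disp e (q + 1 + 1) := by exact_mod_cast hD1
  have hD2' : (disp e (q + 1 + 1) : ℝ) ≤ n + 1 := by exact_mod_cast hD2
  have hr1 := hAt_nonneg η x
  have hr2 := hAt_le_one η x
  have hx1 : (0 : ℝ) ≤ gap e q * gap e (q + 1) := mul_nonneg (hg _).1 (hg _).1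
  have hx2 : (gap e q * gap e (q + 1) : ℝ) ≤ 1 := mul_le_one₀ (hg _).2 (hg _).1 (hg _).2
  have := hg 0
  have := hg q
  have := hg (q + 1)
  -- Here `δ` is the overhang of the last gap beyond the box, and `r` collects the first particle,
  -- whose left neighbour is outside the box, and the last pair of gaps.
  have main := defect_algebra (n := n) (m := ((q + 1 + 1 : ℕ) : ℝ))
    (B := ∑ l ∈ Finset.range (q + 1 + 1), (gap e l : ℝ))
    (B₁ := ∑ l ∈ Finset.range q, (gap e l : ℝ))
    (B₂ := ∑ l ∈ Finset.range q, (gap e (l + 1) : ℝ))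
    (C := ∑ i ∈ Finset.range q, (gap e i * gap e (i + 1) : ℝ))
    (r := 1 - hAt η x + gap e q * gap e (q + 1)) (δ := disp e (q + 1 + 1) - n)
    (by exact_mod_cast (by omega : 0 < n)) (by exact_mod_cast hnp2) (by exact_mod_cast hnp)
    (by rw [hDs]; ring) (by linarith) (by linarith) (by linarith) (by linarith) (by linarith)
    (by linarith) hB2 (by linarith) hC (by linarith) (by linarith) (by linarith)
  refine le_of_eq_of_le ?_ main
  rw [hs3]
  congr 3
  push_cast
  ring

end Root

/-- The site to the right of a hole is occupied, and distinct holes have distinct right neighbours.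
-/
theorem sum_abs_boxDefect_le [NeZero N] {η : Config N} (hη : Isolated η) {n : ℕ} (hn : 0 < n) :
    ∑ x : ZMod N, |boxDefect n η x| ≤
      2 * ∑ x : ZMod N with η x = true, |boxDefect n η x| + 5 * N / n := by
  classical
  rw [← Finset.sum_filter_add_sum_filter_not Finset.univ (fun x : ZMod N => η x = true)]
  have : ∑ x : ZMod N with ¬ η x = true, |boxDefect n η x| ≤
      ∑ x : ZMod N with η x = true, |boxDefect n η x| + 5 * N / n := by
    calc ∑ x : ZMod N with ¬ η x = true, |boxDefect n η x|
        ≤ ∑ x : ZMod N with ¬ η x = true, (|boxDefect n η (x + 1)| + 5 / n) :=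
          Finset.sum_le_sum fun x _ => abs_boxDefect_le_succ hn η x
      _ = ∑ y ∈ (Finset.univ.filter fun x : ZMod N => ¬ η x = true).image (· + 1),
            |boxDefect n η y| + ∑ x : ZMod N with ¬ η x = true, (5 : ℝ) / n := by
          rw [Finset.sum_add_distrib, Finset.sum_image]
          intro a _ b _ h
          exact add_right_cancel h
      _ ≤ ∑ x : ZMod N with η x = true, |boxDefect n η x| + ∑ x : ZMod N, (5 : ℝ) / n := by
          gcongr
          · intro y hy
            obtain ⟨x, hx, rfl⟩ := Finset.mem_image.1 hy
            have h1 := (Finset.mem_filter.1 hx).2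
            exact Finset.mem_filter.2 ⟨Finset.mem_univ _, (hη x).resolve_left h1⟩
          · exact Finset.subset_univ _
      _ = _ := by
          rw [Finset.sum_const, Finset.card_univ, ZMod.card, nsmul_eq_mul]; ring
  linarith

/-- The static estimate: the mean of the local defects is controlled by the variation of the
density along jumps. -/
theorem sum_mul_V_le [NeZero N] {k : ℕ} (hk : 1 ≤ k) (hN : 4 * k + 6 ≤ N) {f : Config N → ℝ}
    (hf : ∀ η, 0 ≤ f η) (hf0 : ∀ η, ¬ Isolated η → f η = 0) (hf1 : ∑ η, f η ≤ 1) {r : ℝ}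
    (hr : 0 < r) :
    ∑ η : Config N, f η * (1 / (N : ℝ) * ∑ x : ZMod N, |V k (shift x η)|) ≤
      2 * r * ((2 * k + 1 : ℕ) : ℝ) / N * bondVariation f + 2 / r +
        (14 * r + 37) / ((2 * k + 1 : ℕ) : ℝ) := by
  classical
  set n := 2 * k + 1 with hn
  have hN0 : (0 : ℝ) < N := by exact_mod_cast (by omega : 0 < N)
  have hn0 : (0 : ℝ) < (n : ℝ) := by exact_mod_cast (by omega : 0 < n)
  -- The factors 2 come from passing to occupied roots, and 37 = 2 · 16 + 5.
  have step : ∀ η : Config N, f η * (1 / (N : ℝ) * ∑ x : ZMod N, |V k (shift x η)|) ≤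
      (2 * r / (N * n ^ 4)) *
        ∑ x : ZMod N, (if η ∈ rooted x then f η * gapForm n (view η x) ^ 2 else 0) +
      f η * (2 / r + 37 / n) := by
    intro η
    by_cases hη : Isolated η
    swap
    · simp [hf0 η hη]
    have e1 : ∑ x : ZMod N, |V k (shift x η)| = ∑ x : ZMod N, |boxDefect n η x| := by
      simp only [V_shift]
      exact Equiv.sum_comp (Equiv.subRight (k : ZMod N)) (fun x => |boxDefect n η x|)
    have e2 : ∑ x : ZMod N, (if η ∈ rooted x then f η * gapForm n (view η x) ^ 2 else 0) =
        f η * ∑ x : ZMod N with η x = true, gapForm n (view η x) ^ 2 := by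
      simp only [mem_rooted, hη, true_and]
      rw [← Finset.sum_filter, Finset.mul_sum]
    have e3 : ∑ x : ZMod N with η x = true, |boxDefect n η x| ≤
        r / n ^ 4 * ∑ x : ZMod N with η x = true, gapForm n (view η x) ^ 2 +
          N * (1 / r + 16 / n) := by
      calc ∑ x : ZMod N with η x = true, |boxDefect n η x|
          ≤ ∑ x : ZMod N with η x = true,
              (r / n ^ 4 * gapForm n (view η x) ^ 2 + (1 / r + 16 / n)) := by
            refine Finset.sum_le_sum fun x hx => ?_
            refine (abs_boxDefect_le hη (by simpa using hx) (by omega : 3 ≤ n)).trans ?_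
            rw [← add_assoc]
            gcongr
            set G := gapForm n (view η x)
            -- Young's inequality with the free weight `r` replaces |G| by its square, the quantity
            -- whose mean is controlled.
            have : r / (n : ℝ) ^ 4 * G ^ 2 + 1 / r - 2 * |G| / (n : ℝ) ^ 2 =
                (1 / r) * (r * |G| / (n : ℝ) ^ 2 - 1) ^ 2 := by
              rw [← sq_abs G]; field_simp; ring
            have h2 : 0 ≤ (1 / r) * (r * |G| / (n : ℝ) ^ 2 - 1) ^ 2 := by positivity
            linarith
        _ = r / n ^ 4 * ∑ x : ZMod N with η x = true, gapForm n (view η x) ^ 2 +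
              ∑ x : ZMod N with η x = true, (1 / r + 16 / (n : ℝ)) := by
            rw [Finset.sum_add_distrib, Finset.mul_sum]
        _ ≤ r / n ^ 4 * ∑ x : ZMod N with η x = true, gapForm n (view η x) ^ 2 +
              ∑ x : ZMod N, (1 / r + 16 / (n : ℝ)) := by
            gcongr
            exact Finset.subset_univ _
        _ = _ := by rw [Finset.sum_const, Finset.card_univ, ZMod.card, nsmul_eq_mul]
    have e4 := sum_abs_boxDefect_le hη (n := n) (by omega)
    rw [e1, e2]
    set S := ∑ x : ZMod N with η x = true, gapForm n (view η x) ^ 2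
    calc f η * (1 / (N : ℝ) * ∑ x : ZMod N, |boxDefect n η x|)
        ≤ f η * (1 / (N : ℝ) * (2 * (r / n ^ 4 * S + N * (1 / r + 16 / n)) + 5 * N / n)) := by
          gcongr
          · exact hf η
          · linarith
      _ = _ := by field_simp; ring
  calc _ ≤ ∑ η : Config N, ((2 * r / (N * n ^ 4)) *
        ∑ x : ZMod N, (if η ∈ rooted x then f η * gapForm n (view η x) ^ 2 else 0) +
      f η * (2 / r + 37 / n)) := Finset.sum_le_sum fun η _ => step η
    _ = (2 * r / (N * n ^ 4)) * ∑ x : ZMod N, ∑ η ∈ rooted x, f η * gapForm n (view η x) ^ 2 +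
          (∑ η, f η) * (2 / r + 37 / n) := by
        rw [Finset.sum_add_distrib, ← Finset.mul_sum, ← Finset.sum_mul, Finset.sum_comm]
        simp only [Finset.sum_ite_mem, Finset.univ_inter]
    _ ≤ (2 * r / (N * n ^ 4)) * (n ^ 5 * bondVariation f + 7 * N * n ^ 3) +
          1 * (2 / r + 37 / n) := by
        gcongr
        exact sum_gapForm_sq_le (by omega) hf hf1
    _ = _ := by field_simp; ring

end

/-! ### Reversibility on isolated configurations and the entropy estimate. -/

section

variable {N : ℕ}

/-- The site beyond a hole is occupied automatically, so the one-sided constraint amounts to both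
outer sites being occupied. This form is symmetric under the exchange, whence reversibility. -/
theorem rate_eq_ite {η : Config N} (hη : Isolated η) (x : ZMod N) :
    rate η x = if η (x - 1) = true ∧ η x ≠ η (x + 1) ∧ η (x + 2) = true then 1 else 0 := by
  have h1 := hη (x - 1)
  have h2 := hη (x + 1)
  rw [sub_add_cancel] at h1
  rw [add_assoc, one_add_one_eq_two] at h2
  unfold rate occ
  rcases Bool.eq_false_or_eq_true (η (x - 1)) with a | a <;>
    rcases Bool.eq_false_or_eq_true (η x) with b | b <;>
    rcases Bool.eq_false_or_eq_true (η (x + 1)) with c | c <;>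
    rcases Bool.eq_false_or_eq_true (η (x + 2)) with d | d <;> simp_all

theorem rate_le_one {η : Config N} (hη : Isolated η) (x : ZMod N) : rate η x ≤ 1 := by
  rw [rate_eq_ite hη]; split_ifs <;> norm_num

/-- The jumps between configurations without neighbouring holes are reversible. -/
theorem exchange_reversible (hN : 4 ≤ N) {η : Config N} (hη : Isolated η) {x : ZMod N}
    (hr : rate η x ≠ 0) : Isolated (exchange η x (x + 1)) ∧ rate (exchange η x (x + 1)) x =
      rate η x := by
  rw [rate_eq_ite hη] at hr
  have hc : η (x - 1) = true ∧ η x ≠ η (x + 1) ∧ η (x + 2) = true := by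
    by_contra h; rw [if_neg h] at hr; exact hr rfl
  obtain ⟨h1, h2, h3⟩ := hc
  have hI := hη.exchange hN h1 h2 h3
  refine ⟨hI, ?_⟩
  have hd : ∀ a b : ℕ, a < N → b < N → a ≠ b → x - 1 + (a : ZMod N) ≠ x - 1 + (b : ZMod N) :=
    fun a b ha hb hab h => hab ((add_natCast_inj ha hb).1 h)
  have e1 : x - 1 + ((1 : ℕ) : ZMod N) = x := by push_cast; ring
  have e2 : x - 1 + ((2 : ℕ) : ZMod N) = x + 1 := by push_cast; ring
  have e3 : x - 1 + ((3 : ℕ) : ZMod N) = x + 2 := by push_cast; ring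
  have e0 : x - 1 + ((0 : ℕ) : ZMod N) = x - 1 := by push_cast; ring
  have c01 := hd 0 1 (by omega) (by omega) (by omega)
  have c02 := hd 0 2 (by omega) (by omega) (by omega)
  have c31 := hd 3 1 (by omega) (by omega) (by omega)
  have c32 := hd 3 2 (by omega) (by omega) (by omega)
  rw [e0, e1] at c01
  rw [e0, e2] at c02
  rw [e3, e1] at c31
  rw [e3, e2] at c32
  rw [rate_eq_ite hI, rate_eq_ite hη, if_pos (c := η (x - 1) = true ∧ _) ⟨h1, h2, h3⟩, if_pos]
  simp only [exchange, Equiv.swap_apply_left, Equiv.swap_apply_right,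
    Equiv.swap_apply_of_ne_of_ne c01 c02, Equiv.swap_apply_of_ne_of_ne c31 c32]
  exact ⟨h1, h2.symm, h3⟩

variable [NeZero N]

open Classical in
/-- The set of configurations without neighbouring holes. -/
noncomputable def isolatedSet (N : ℕ) [NeZero N] : Finset (Config N) :=
  Finset.univ.filter fun η => Isolated η

theorem mem_isolatedSet {η : Config N} : η ∈ isolatedSet N ↔ Isolated η := by simp [isolatedSet]

/-- Detailed balance for the counting measure on isolated configurations. -/
theorem sum_rate_symm (hN : 4 ≤ N) (A : Config N → Config N → ℝ) :
    ∑ η ∈ isolatedSet N, ∑ x : ZMod N, rate η x * A η (exchange η x (x + 1)) =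
      ∑ η ∈ isolatedSet N, ∑ x : ZMod N, rate η x * A (exchange η x (x + 1)) η := by
  classical
  rw [Finset.sum_comm, Finset.sum_comm (t := Finset.univ)]
  refine Finset.sum_congr rfl fun x _ => ?_
  have h1 : ∀ B : Config N → ℝ, ∑ η ∈ isolatedSet N, rate η x * B η =
      ∑ η ∈ isolatedSet N with rate η x ≠ 0, rate η x * B η := by
    intro B
    rw [Finset.sum_filter_of_ne]
    intro η _ h h0
    exact h (by rw [h0, zero_mul])
  rw [h1, h1]
  have hmem : ∀ η ∈ (isolatedSet N).filter (fun η => rate η x ≠ 0),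
      exchange η x (x + 1) ∈ (isolatedSet N).filter (fun η => rate η x ≠ 0) := by
    intro η hη
    rw [Finset.mem_filter, mem_isolatedSet] at *
    obtain ⟨h2, h3⟩ := exchange_reversible hN hη.1 hη.2
    exact ⟨h2, by rw [h3]; exact hη.2⟩
  refine Finset.sum_nbij' (fun η => exchange η x (x + 1)) (fun η => exchange η x (x + 1)) hmem hmem
    (fun η _ => exchange_exchange _ _ _) (fun η _ => exchange_exchange _ _ _) fun η hη => ?_
  rw [Finset.mem_filter, mem_isolatedSet] at hη
  rw [exchange_exchange, (exchange_reversible hN hη.1 hη.2).2]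

theorem sum_mul_generator (hN : 4 ≤ N) (f ψ : Config N → ℝ) :
    ∑ η ∈ isolatedSet N, f η * generator ψ η = -(1 / 2) * ∑ η ∈ isolatedSet N, ∑ x : ZMod N,
      rate η x * ((f (exchange η x (x + 1)) - f η) * (ψ (exchange η x (x + 1)) - ψ η)) := by
  have h1 := sum_rate_symm hN (fun η η' => f η * (ψ η' - ψ η))
  have h2 : ∑ η ∈ isolatedSet N, f η * generator ψ η =
      ∑ η ∈ isolatedSet N, ∑ x : ZMod N,
        rate η x * (f η * (ψ (exchange η x (x + 1)) - ψ η)) := by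
    refine Finset.sum_congr rfl fun η _ => ?_
    rw [generator, Finset.mul_sum]
    exact Finset.sum_congr rfl fun x _ => by ring
  have h3 : ∑ η ∈ isolatedSet N, ∑ x : ZMod N,
      rate η x * ((f (exchange η x (x + 1)) - f η) * (ψ (exchange η x (x + 1)) - ψ η)) =
      -(∑ η ∈ isolatedSet N, ∑ x : ZMod N,
        rate η x * (f (exchange η x (x + 1)) * (ψ η - ψ (exchange η x (x + 1))))) -
      ∑ η ∈ isolatedSet N, ∑ x : ZMod N,
        rate η x * (f η * (ψ (exchange η x (x + 1)) - ψ η)) := by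
    simp only [← Finset.sum_neg_distrib, ← Finset.sum_sub_distrib]
    exact Finset.sum_congr rfl fun η _ => Finset.sum_congr rfl fun x _ => by ring
  rw [h3, ← h1, h2]; ring

theorem sum_generatorMatrix_mul (φ : Config N → ℝ) (η : Config N) :
    ∑ η', generatorMatrix N η η' * φ η' = generator φ η := by
  simp only [generatorMatrix, Matrix.of_apply, generator, Finset.sum_mul]
  rw [Finset.sum_comm]
  refine Finset.sum_congr rfl fun x _ => ?_
  simp only [mul_assoc, ← Finset.mul_sum, sub_mul, Finset.sum_sub_distrib]
  congr 1
  simp [Pi.single_apply]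

theorem generatorMatrix_eq_zero (hN : 4 ≤ N) {η η' : Config N} (hη : Isolated η)
    (hη' : ¬ Isolated η') : generatorMatrix N η η' = 0 := by
  rw [generatorMatrix, Matrix.of_apply, generator]
  refine Finset.sum_eq_zero fun x _ => ?_
  by_cases hr : rate η x = 0
  · rw [hr, zero_mul]
  · have h1 : exchange η x (x + 1) ≠ η' := fun h => hη' (h ▸ (exchange_reversible hN hη hr).1)
    have h2 : η ≠ η' := fun h => hη' (h ▸ hη)
    rw [Pi.single_eq_of_ne h1, Pi.single_eq_of_ne h2, sub_zero, mul_zero]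

/-- The generator is block triangular for the splitting into isolated and other configurations, and
the exponential preserves this. -/
theorem transition_eq_zero (hN : 4 ≤ N) (t : ℝ) {η η' : Config N} (hη : Isolated η)
    (hη' : ¬ Isolated η') : transition N t η η' = 0 := by
  classical
  have : ((t * (N : ℝ) ^ 2) • generatorMatrix N).BlockTriangular
      (fun η => if Isolated η then 1 else 0) := by
    intro a b hab
    by_cases ha : Isolated a <;> by_cases hb : Isolated b <;> simp [ha, hb] at hab
    rw [Matrix.smul_apply, generatorMatrix_eq_zero hN ha hb, smul_zero]
  exact this.exp (by simp [hη, hη'])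

theorem transition_zero : transition N 0 = 1 := by
  rw [transition, zero_mul, zero_smul, NormedSpace.exp_zero]

open scoped Matrix.Norms.Operator in
theorem hasDerivAt_transition (a b : Config N) (t : ℝ) :
    HasDerivAt (fun t => transition N t a b)
      ((N : ℝ) ^ 2 * ∑ c, transition N t a c * generatorMatrix N c b) t := by
  have h1 := hasDerivAt_exp_smul_const (𝕂 := ℝ) ((N : ℝ) ^ 2 • generatorMatrix N) t
  have h2 := (LinearMap.toContinuousLinearMap
    (Matrix.entryLinearMap ℝ ℝ a b : Matrix (Config N) (Config N) ℝ →ₗ[ℝ] ℝ)).hasFDerivAt.comp_hasDerivAt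
      t h1
  refine h2.congr_deriv ?_ |>.congr_of_eventuallyEq ?_
  · simp only [transition, smul_smul, Finset.mul_sum]
    exact Finset.sum_congr rfl fun c _ => mul_left_comm _ ((N : ℝ) ^ 2) (generatorMatrix N c b)
  · refine Eventually.of_forall fun u => ?_
    simp only [transition, smul_smul, Function.comp_apply]
    rfl

theorem sum_transition (a : Config N) (t : ℝ) : ∑ b, transition N t a b = 1 := by
  have h : ∀ t, HasDerivAt (fun t => ∑ b, transition N t a b) 0 t := by
    intro t
    refine (HasDerivAt.fun_sum fun b _ => hasDerivAt_transition a b t).congr_deriv ?_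
    rw [← Finset.mul_sum, Finset.sum_comm]
    simp only [← Finset.mul_sum]
    have : ∀ c, ∑ b, generatorMatrix N c b = 0 := by
      intro c
      have := sum_generatorMatrix_mul (fun _ => (1 : ℝ)) c
      simpa [generator] using this
    simp [this]
  have := is_const_of_deriv_eq_zero (fun t => (h t).differentiableAt) (fun t => (h t).deriv) t 0
  rw [this, transition_zero]
  simp [Matrix.one_apply]

theorem continuous_transition (a b : Config N) : Continuous fun t => transition N t a b :=
  continuous_iff_continuousAt.2 fun t => (hasDerivAt_transition a b t).continuousAt

/-- The forward equation tested against `ψ`; both sums can be restricted to isolated configurations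
because these are closed under the dynamics. -/
theorem sum_deriv_transition_mul (hN : 4 ≤ N) {a : Config N} (ha : Isolated a) (t : ℝ)
    (ψ : Config N → ℝ) :
    ∑ b ∈ isolatedSet N, ((N : ℝ) ^ 2 * ∑ c, transition N t a c * generatorMatrix N c b) * ψ b =
      (N : ℝ) ^ 2 * ∑ c ∈ isolatedSet N, transition N t a c * generator ψ c := by
  have e1 : ∀ b, ∑ c, transition N t a c * generatorMatrix N c b =
      ∑ c ∈ isolatedSet N, transition N t a c * generatorMatrix N c b := by
    intro b
    refine (Finset.sum_subset (Finset.subset_univ _) fun c _ hc => ?_).symm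
    rw [transition_eq_zero hN t ha (fun h => hc (mem_isolatedSet.2 h)), zero_mul]
  have e2 : ∀ c ∈ isolatedSet N, generator ψ c =
      ∑ b ∈ isolatedSet N, generatorMatrix N c b * ψ b := by
    intro c hc
    rw [← sum_generatorMatrix_mul]
    refine (Finset.sum_subset (Finset.subset_univ _) fun b _ hb => ?_).symm
    rw [generatorMatrix_eq_zero hN (mem_isolatedSet.1 hc) (fun h => hb (mem_isolatedSet.2 h)),
      zero_mul]
  simp only [e1, mul_assoc, ← Finset.mul_sum]
  congr 1
  simp only [Finset.sum_mul]
  rw [Finset.sum_comm]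
  refine Finset.sum_congr rfl fun c hc => ?_
  rw [e2 c hc, Finset.mul_sum]
  exact Finset.sum_congr rfl fun b _ => by ring

/-- The entropy production of the positive function `g`. -/
noncomputable def entropyProduction (g : Config N → ℝ) : ℝ :=
  ∑ η ∈ isolatedSet N, ∑ x : ZMod N, rate η x *
    ((g (exchange η x (x + 1)) - g η) * (Real.log (g (exchange η x (x + 1))) - Real.log (g η)))

/-- For b ≤ a this follows from log(a/b) ≥ 1 - b/a. It is the input that lets entropy production
control an ℓ¹ variation. -/
theorem sq_sub_le_mul_log {a b : ℝ} (ha : 0 < a) (hb : 0 < b) :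
    (a - b) ^ 2 ≤ (a - b) * (Real.log a - Real.log b) * (a + b) := by
  wlog hab : b ≤ a generalizing a b
  · have := this hb ha (by linarith)
    linarith
  have h1 : (a - b) / a ≤ Real.log a - Real.log b := by
    rw [← Real.log_div ha.ne' hb.ne']
    have := Real.one_sub_inv_le_log_of_pos (div_pos ha hb)
    rw [inv_div] at this
    rwa [sub_div, div_self ha.ne']
  have h2 : a - b ≤ (Real.log a - Real.log b) * (a + b) := by
    rw [div_le_iff₀ ha] at h1
    have : 0 ≤ Real.log a - Real.log b := by linarith [Real.log_le_log hb hab]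
    nlinarith
  nlinarith

/-- The inequality |a - b| ≤ √(X(a + b)), with X the entropy produced by a jump, is split with
weight N. The production then gets the factor N/2, and the mass, summed over N bonds, contributes a
constant. -/
theorem bondVariation_le_entropyProduction (hN : 4 ≤ N) {f g : Config N → ℝ} {δ : ℝ}
    (hg : ∀ η, 0 < g η) (hfg : ∀ η, g η = f η + δ) (hsum : ∑ η ∈ isolatedSet N, g η ≤ 2) :
    bondVariation f ≤ (N * entropyProduction g + 4) / 2 := by
  have hN0 : (0 : ℝ) < N := by exact_mod_cast (by omega : 0 < N)
  have key : ∀ a b : ℝ, 0 < a → 0 < b → |a - b| ≤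
      (N / 2) * ((a - b) * (Real.log a - Real.log b)) + (1 / (2 * N)) * (a + b) := by
    intro a b ha hb
    have h1 := sq_sub_le_mul_log ha hb
    set X := (a - b) * (Real.log a - Real.log b)
    have h2 : 0 ≤ N / 2 * X + 1 / (2 * N) * (a + b) := by
      have : 0 ≤ X := by
        by_contra h
        push Not at h
        have h3 : X * (a + b) < 0 := mul_neg_of_neg_of_pos h (by positivity)
        linarith [sq_nonneg (a - b)]
      positivity
    refine abs_le_of_sq_le_sq ?_ h2
    have h3 : (N / 2 * X + 1 / (2 * N) * (a + b)) ^ 2 =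
        X * (a + b) + (N / 2 * X - 1 / (2 * N) * (a + b)) ^ 2 := by
      field_simp; ring
    rw [h3]
    linarith [sq_nonneg (N / 2 * X - 1 / (2 * N) * (a + b))]
  have e1 : bondVariation f = ∑ η ∈ isolatedSet N, ∑ x : ZMod N,
      rate η x * |g (exchange η x (x + 1)) - g η| := by
    simp only [hfg, add_sub_add_right_eq_sub]; rfl
  have e2 : ∑ η ∈ isolatedSet N, ∑ x : ZMod N, rate η x * g η ≤ 2 * N := by
    calc _ ≤ ∑ η ∈ isolatedSet N, ∑ x : ZMod N, g η := by
          refine Finset.sum_le_sum fun η hη => Finset.sum_le_sum fun x _ => ?_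
          exact mul_le_of_le_one_left (hg η).le (rate_le_one (mem_isolatedSet.1 hη) x)
      _ = N * ∑ η ∈ isolatedSet N, g η := by
          simp only [Finset.sum_const, Finset.card_univ, ZMod.card, nsmul_eq_mul, Finset.mul_sum]
      _ ≤ N * 2 := by gcongr
      _ = 2 * N := by ring
  have e3 := sum_rate_symm hN (fun η _ => g η)
  rw [e1]
  calc _ ≤ ∑ η ∈ isolatedSet N, ∑ x : ZMod N, ((N / 2) * (rate η x *
        ((g (exchange η x (x + 1)) - g η) *
          (Real.log (g (exchange η x (x + 1))) - Real.log (g η)))) +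
        (1 / (2 * N)) * (rate η x * g (exchange η x (x + 1)) + rate η x * g η)) := by
        refine Finset.sum_le_sum fun η _ => Finset.sum_le_sum fun x _ => ?_
        refine (mul_le_mul_of_nonneg_left (key _ _ (hg _) (hg _)) (rate_nonneg η x)).trans_eq ?_
        ring
    _ = (N / 2) * entropyProduction g + (1 / (2 * N)) *
          (2 * ∑ η ∈ isolatedSet N, ∑ x : ZMod N, rate η x * g η) := by
        simp only [Finset.sum_add_distrib, ← Finset.mul_sum]
        rw [← e3, entropyProduction]; ring
    _ ≤ (N / 2) * entropyProduction g + (1 / (2 * N)) * (2 * (2 * N)) := by gcongr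
    _ = _ := by field_simp; ring

theorem continuous_bondVariation (a : Config N) :
    Continuous fun t => bondVariation (transition N t a) := by
  unfold bondVariation
  refine continuous_finsetSum _ fun η _ => continuous_finsetSum _ fun x _ => ?_
  exact continuous_const.mul ((continuous_transition a _).sub (continuous_transition a _)).abs

/-- The dynamical estimate: the integrated variation of the law of the process along jumps is
bounded uniformly in the size of the torus. -/
theorem integral_bondVariation_le (hN : 4 ≤ N) {a : Config N} (ha : Isolated a)
    (hpos : ∀ t, 0 ≤ t → ∀ b, 0 ≤ transition N t a b) {T : ℝ} (hT : 0 ≤ T) :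
    ∫ t in (0 : ℝ)..T, bondVariation (transition N t a) ≤ 4 + 2 * T := by
  have hN0 : (0 : ℝ) < N := by exact_mod_cast (by omega : 0 < N)
  have hcard : 0 < (isolatedSet N).card := Finset.card_pos.2 ⟨a, mem_isolatedSet.2 ha⟩
  have hcard2 : ((isolatedSet N).card : ℝ) ≤ 2 ^ N := by
    have : (isolatedSet N).card ≤ 2 ^ N := by
      refine (Finset.card_le_univ _).trans_eq ?_
      simp [ZMod.card]
    exact_mod_cast this
  -- Adding this constant makes the density strictly positive, so that its logarithm is
  -- differentiable, while the total mass is only doubled and increments are unchanged.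
  set δ : ℝ := 1 / (isolatedSet N).card with hδ
  have hc0 : (0 : ℝ) < (isolatedSet N).card := by exact_mod_cast hcard
  have hδ0 : 0 < δ := by positivity
  have hδ1 : δ ≤ 1 := by
    rw [hδ, div_le_one hc0]; exact_mod_cast hcard
  set g : ℝ → Config N → ℝ := fun t η => transition N t a η + δ with hg
  have hg0 : ∀ t, 0 ≤ t → ∀ η, δ ≤ g t η := fun t ht η => by
    simp only [hg]; linarith [hpos t ht η]
  have hgsum : ∀ t, ∑ η ∈ isolatedSet N, g t η = 2 := by
    intro t
    simp only [hg, Finset.sum_add_distrib, Finset.sum_const, nsmul_eq_mul]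
    have h1 : ∑ η ∈ isolatedSet N, transition N t a η = 1 := by
      rw [← sum_transition a t]
      refine Finset.sum_subset (Finset.subset_univ _) fun c _ hc => ?_
      exact transition_eq_zero hN t ha fun h => hc (mem_isolatedSet.2 h)
    rw [h1, hδ, mul_one_div_cancel hc0.ne']; norm_num
  have hf1 : ∀ t, 0 ≤ t → ∀ η, transition N t a η ≤ 1 := by
    intro t ht η
    rw [← sum_transition a t]
    exact Finset.single_le_sum (fun b _ => hpos t ht b) (Finset.mem_univ η)
  set H : ℝ → ℝ := fun t => ∑ η ∈ isolatedSet N, g t η * Real.log (g t η) with hH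
  -- The constant 1 in the derivative of x log x disappears in the increments of the Dirichlet form.
  have hderiv : ∀ t ∈ Set.uIcc 0 T, HasDerivAt H
      (-((N : ℝ) ^ 2 / 2) * entropyProduction (g t)) t := by
    intro t ht
    rw [Set.uIcc_of_le hT] at ht
    have h1 : ∀ η, HasDerivAt (fun t => g t η * Real.log (g t η))
        (((N : ℝ) ^ 2 * ∑ c, transition N t a c * generatorMatrix N c η) *
          (Real.log (g t η) + 1)) t := by
      intro η
      have h2 : HasDerivAt (fun t => g t η) _ t := (hasDerivAt_transition a η t).add_const δ
      have h3 : g t η ≠ 0 := (hδ0.trans_le (hg0 t ht.1 η)).ne'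
      have h4 := (Real.hasDerivAt_mul_log h3).comp t h2
      refine h4.congr_deriv (by ring)
    refine (HasDerivAt.fun_sum fun η _ => h1 η).congr_deriv ?_
    rw [sum_deriv_transition_mul hN ha t (fun η => Real.log (g t η) + 1), sum_mul_generator hN,
      entropyProduction]
    simp only [hg, add_sub_add_right_eq_sub]
    ring
  have hcontg : ∀ η, Continuous fun t => g t η := fun η =>
    (continuous_transition a η).add continuous_const
  have hcontD : ContinuousOn (fun t => entropyProduction (g t)) (Set.uIcc 0 T) := by
    rw [Set.uIcc_of_le hT]
    have hlog : ∀ η, ContinuousOn (fun t => Real.log (g t η)) (Set.Icc 0 T) := fun η =>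
      (hcontg η).continuousOn.log fun t ht => (hδ0.trans_le (hg0 t ht.1 η)).ne'
    unfold entropyProduction
    refine continuousOn_finsetSum _ fun η _ => continuousOn_finsetSum _ fun x _ => ?_
    exact continuousOn_const.mul
      (((hcontg _).continuousOn.sub (hcontg _).continuousOn).mul ((hlog _).sub (hlog _)))
  have hint := intervalIntegral.integral_eq_sub_of_hasDerivAt hderiv
    (hcontD.const_smul (-((N : ℝ) ^ 2 / 2))).intervalIntegrable
  rw [intervalIntegral.integral_const_mul] at hint
  have hcontB := continuous_bondVariation a
  have hle : ∫ t in (0 : ℝ)..T, bondVariation (transition N t a) ≤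
      ∫ t in (0 : ℝ)..T, ((N / 2) * entropyProduction (g t) + 2) := by
    refine intervalIntegral.integral_mono_on hT (hcontB.intervalIntegrable _ _)
      ((hcontD.const_smul ((N : ℝ) / 2)).add continuousOn_const).intervalIntegrable fun t ht => ?_
    have := bondVariation_le_entropyProduction hN (f := transition N t a) (g := g t) (δ := δ)
      (fun η => hδ0.trans_le (hg0 t ht.1 η)) (fun η => rfl) (hgsum t).le
    linarith
  have hsplit : ∫ t in (0 : ℝ)..T, ((N / 2) * entropyProduction (g t) + 2) =
      (∫ t in (0 : ℝ)..T, (N / 2) * entropyProduction (g t)) + ∫ _ in (0 : ℝ)..T, (2 : ℝ) :=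
    intervalIntegral.integral_add (hcontD.const_smul ((N : ℝ) / 2)).intervalIntegrable
      (by simp)
  rw [hsplit, intervalIntegral.integral_const_mul] at hle
  simp only [intervalIntegral.integral_const, sub_zero, smul_eq_mul] at hle
  set D := ∫ t in (0 : ℝ)..T, entropyProduction (g t)
  have hlog2 : Real.log 2 ≤ 1 := by have := Real.log_two_lt_d9; linarith
  have hlog2' : 0 ≤ Real.log 2 := Real.log_nonneg (by norm_num)
  have hH0 : H 0 ≤ 2 := by
    calc H 0 ≤ ∑ η ∈ isolatedSet N, g 0 η * Real.log 2 := by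
          refine Finset.sum_le_sum fun η _ => ?_
          have h0 := hδ0.trans_le (hg0 0 le_rfl η)
          refine mul_le_mul_of_nonneg_left (Real.log_le_log h0 ?_) h0.le
          have := hf1 0 le_rfl η
          simp only [hg]; linarith
      _ = 2 * Real.log 2 := by rw [← Finset.sum_mul, hgsum]
      _ ≤ 2 := by linarith
  have hHT : -(2 * N) ≤ H T := by
    have hlogδ : -(N : ℝ) ≤ Real.log δ := by
      rw [hδ, one_div, Real.log_inv]
      have h1 : Real.log (isolatedSet N).card ≤ Real.log (2 ^ N) := Real.log_le_log hc0 hcard2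
      rw [Real.log_pow] at h1
      nlinarith
    calc -(2 * (N : ℝ)) ≤ 2 * Real.log δ := by linarith
      _ = ∑ η ∈ isolatedSet N, g T η * Real.log δ := by rw [← Finset.sum_mul, hgsum]
      _ ≤ H T := by
          refine Finset.sum_le_sum fun η _ => ?_
          have h0 := hg0 T hT η
          exact mul_le_mul_of_nonneg_left (Real.log_le_log hδ0 h0) (hδ0.le.trans h0)
  have hN4 : (4 : ℝ) ≤ N := by exact_mod_cast hN
  -- The entropy drops by at most 2 + 2N, because there are at most 2^N isolated configurations, and
  -- this drop is N²/2 times the integrated production.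
  have hD : N / 2 * D ≤ 4 := by
    have h1 : (N : ℝ) * (N / 2 * D) ≤ 2 + 2 * N := by nlinarith
    by_contra h
    push Not at h
    nlinarith
  linarith

end

/-! ### From transition matrices to trajectories and the conditioned initial measure. -/

section Trajectories

variable {N : ℕ} [NeZero N] {Ω : Type*} [MeasurableSpace Ω] {Pr : Config N → Measure Ω}
  {η : ℝ≥0 → Ω → Config N}

theorem IsProcess.measurableSet_eq (hη : IsProcess Pr η) (s : ℝ≥0) (b : Config N) :
    MeasurableSet {ω | η s ω = b} := hη.measurable s (measurableSet_singleton b)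

theorem IsProcess.ae_start (hη : IsProcess Pr η) (a : Config N) : ∀ᵐ ω ∂(Pr a), η 0 ω = a := by
  have := hη.isProbabilityMeasure a
  have h := hη.finite_dimensional 0 (fun _ => 0) monotone_const rfl (fun _ => a)
  simp only [Nat.le_zero, forall_eq, Finset.range_zero, Finset.prod_empty, ENNReal.ofReal_one] at h
  rw [ae_iff]
  exact (prob_compl_eq_zero_iff (hη.measurableSet_eq 0 a)).2 h

theorem IsProcess.prob_eq (hη : IsProcess Pr η) (a b : Config N) (s : ℝ≥0) :
    Pr a {ω | η s ω = b} = ENNReal.ofReal (transition N s a b) := by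
  have h := hη.finite_dimensional 1 (fun i => if i = 0 then 0 else s) (fun i j hij => by
      by_cases hi : i = 0 <;> by_cases hj : j = 0 <;> simp [hi, hj]; omega) rfl
    (fun i => if i = 0 then a else b)
  simp only [Finset.range_one, Finset.prod_singleton, if_true, zero_add, one_ne_zero, if_false,
    NNReal.coe_zero, sub_zero] at h
  rw [← h]
  refine measure_congr ?_
  filter_upwards [hη.ae_start a] with ω hω
  refine propext ⟨fun h i hi => ?_, fun h => ?_⟩
  · rcases Nat.le_one_iff_eq_zero_or_eq_one.1 hi with rfl | rfl
    · simpa using hω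
    · exact h
  · exact h 1 le_rfl

theorem IsProcess.prob_eq_and_eq (hη : IsProcess Pr η) (a b c : Config N) {s t : ℝ≥0}
    (hst : s ≤ t) : Pr a {ω | η s ω = b ∧ η t ω = c} =
      ENNReal.ofReal (transition N s a b * transition N ((t : ℝ) - s) b c) := by
  have h := hη.finite_dimensional 2 (fun i => if i = 0 then 0 else if i = 1 then s else t)
    (fun i j hij => by
      by_cases hi : i = 0 <;> by_cases hj : j = 0 <;> by_cases hi1 : i = 1 <;>
        by_cases hj1 : j = 1 <;> simp [hi, hj, hi1, hj1, hst] <;> omega) rfl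
    (fun i => if i = 0 then a else if i = 1 then b else c)
  simp only [Finset.prod_range_succ, Finset.prod_range_zero, one_mul, if_true, zero_add,
    one_ne_zero, if_false, NNReal.coe_zero, sub_zero, Nat.reduceAdd, OfNat.ofNat_ne_zero,
    OfNat.ofNat_ne_one] at h
  rw [← h]
  refine measure_congr ?_
  filter_upwards [hη.ae_start a] with ω hω
  refine propext ⟨fun h i hi => ?_, fun h => ?_⟩
  · obtain ⟨h1, h2⟩ := h
    interval_cases i
    · simpa using hω
    · simpa using h1
    · simpa using h2
  · exact ⟨by simpa using h 1 (by norm_num), by simpa using h 2 le_rfl⟩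

/-- The probabilities give only the positive parts of the entries. These sum to 1, and so do the
entries themselves, so no entry is negative. -/
theorem IsProcess.transition_nonneg (hη : IsProcess Pr η) (a b : Config N) {t : ℝ} (ht : 0 ≤ t) :
    0 ≤ transition N t a b := by
  have := hη.isProbabilityMeasure a
  lift t to ℝ≥0 using ht
  have h1 : ∑ b, ENNReal.ofReal (transition N t a b) = 1 := by
    have h2 : ∫⁻ _, (1 : ℝ≥0∞) ∂((Pr a).map (η t)) = 1 := by
      rw [lintegral_one, Measure.map_apply (hη.measurable t) MeasurableSet.univ]; simp
    rw [lintegral_fintype] at h2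
    rw [← h2]
    refine Finset.sum_congr rfl fun b _ => ?_
    rw [one_mul, Measure.map_apply (hη.measurable t) (measurableSet_singleton b), ← hη.prob_eq]
    rfl
  have h3 : ∑ b, max (transition N t a b) 0 = 1 := by
    have := congrArg ENNReal.toReal h1
    rw [ENNReal.toReal_sum (fun _ _ => ENNReal.ofReal_ne_top)] at this
    simpa only [ENNReal.toReal_ofReal', ENNReal.toReal_one] using this
  have h4 := sum_transition a (t : ℝ)
  have h5 : ∑ b, (max (transition N t a b) 0 - transition N t a b) = 0 := by
    rw [Finset.sum_sub_distrib, h3, h4, sub_self]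
  have h6 := (Finset.sum_eq_zero_iff_of_nonneg
    (fun b _ => sub_nonneg.2 (le_max_left _ _))).1 h5 b (Finset.mem_univ b)
  have h7 := le_max_right (transition N t a b) 0
  linarith

theorem isolated_of_mem_ergodic {a : Config N} (ha : a ∈ ergodic N) : Isolated a := by
  intro x
  have := ha.1 x
  rcases Bool.eq_false_or_eq_true (a x) with h1 | h1 <;>
    rcases Bool.eq_false_or_eq_true (a (x + 1)) with h2 | h2 <;> simp_all

/-- If the path avoided the ergodic component up to time `t`, right continuity would keep it
constant for a little longer, and the infimum would exceed `t`. -/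
theorem IsProcess.exists_mem_ergodic (hη : IsProcess Pr η) {ω : Ω} {t : ℝ≥0}
    (h : hittingTime η ω ≤ t) : ∃ s ≤ t, η s ω ∈ ergodic N := by
  by_contra hno
  push Not at hno
  obtain ⟨u, hu, hu'⟩ := (mem_nhdsGT_iff_exists_Ioo_subset' (lt_add_one t)).1
    (hη.right_continuous ω t)
  have hu : t < u := hu
  have : (u : ℝ≥0∞) ≤ hittingTime η ω := by
    refine le_iInf₂ fun s hs => ?_
    by_contra hlt
    push Not at hlt
    have hlt : s < u := by exact_mod_cast hlt
    have hts : t < s := by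
      by_contra hle
      exact hno s (not_lt.1 hle) hs.2
    have h1 : η s ω = η t ω := hu' ⟨hts, hlt⟩
    exact hno t le_rfl (h1 ▸ hs.2)
  exact absurd (this.trans h) (not_le.2 (by exact_mod_cast hu))

/-- By right continuity, the isolated configuration reached at the random time is still present at
some time of a countable dense set before `t`. Two-time distributions at deterministic times then
suffice, and no strong Markov property is needed. -/
theorem IsProcess.null_of_not_isolated (hN : 4 ≤ N) (hη : IsProcess Pr η) (a : Config N)
    {c : Config N} (hc : ¬ Isolated c) (t : ℝ≥0) :
    Pr a ({ω | hittingTime η ω ≤ t} ∩ {ω | η t ω = c}) = 0 := by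
  have hsub : {ω | hittingTime η ω ≤ t} ∩ {ω | η t ω = c} ⊆
      ⋃ n : ℕ, ⋃ b : Config N, {ω | TopologicalSpace.denseSeq ℝ≥0 n ≤ t ∧ Isolated b ∧
        η (TopologicalSpace.denseSeq ℝ≥0 n) ω = b ∧ η t ω = c} := by
    rintro ω ⟨h1, h2⟩
    obtain ⟨s, hst, hs⟩ := hη.exists_mem_ergodic h1
    have hlt : s < t := by
      refine lt_of_le_of_ne hst ?_
      rintro rfl
      exact hc (h2 ▸ isolated_of_mem_ergodic hs)
    obtain ⟨u, hu, hu'⟩ := (mem_nhdsGT_iff_exists_Ioo_subset' hlt).1 (hη.right_continuous ω s)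
    obtain ⟨n, hn⟩ := (TopologicalSpace.denseRange_denseSeq ℝ≥0).exists_mem_open
      (isOpen_Ioo (a := s) (b := min u t)) (Set.nonempty_Ioo.2 (lt_min hu hlt))
    have h3 : η (TopologicalSpace.denseSeq ℝ≥0 n) ω = η s ω := hu' ⟨hn.1, hn.2.trans_le (min_le_left _ _)⟩
    refine Set.mem_iUnion₂.2 ⟨n, η s ω, ?_, isolated_of_mem_ergodic hs, h3, h2⟩
    exact (hn.2.trans_le (min_le_right _ _)).le
  refine measure_mono_null hsub (measure_iUnion_null fun n => measure_iUnion_null fun b => ?_)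
  by_cases hle : TopologicalSpace.denseSeq ℝ≥0 n ≤ t
  swap
  · simp [hle]
  by_cases hb : Isolated b
  swap
  · simp [hb]
  simp only [hle, hb, true_and]
  rw [hη.prob_eq_and_eq a b c hle, transition_eq_zero hN _ hb hc]
  simp

theorem conditionedMeasure_singleton (hN : 4 ≤ N) (hη : IsProcess Pr η) (ρ₀ : ℝ → ℝ)
    {c : Config N} (hc : ¬ Isolated c) : conditionedMeasure ρ₀ Pr η {c} = 0 := by
  rw [conditionedMeasure, Measure.map_apply (hη.measurable _) (measurableSet_singleton c),
    -- This form asks for measurability of the event evaluated, not of the hitting event.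
    cond_apply' (hη.measurable _ (measurableSet_singleton c)), startedFrom]
  refine mul_eq_zero_of_right _ ?_
  rw [Measure.finsetSum_apply]
  refine Finset.sum_eq_zero fun a _ => ?_
  rw [Measure.smul_apply]
  have := hη.null_of_not_isolated hN a hc (transienceTime N)
  rw [smul_eq_mul]
  exact mul_eq_zero_of_right _ this

theorem conditionedMeasure_univ_le (hη : IsProcess Pr η) (ρ₀ : ℝ → ℝ) :
    conditionedMeasure ρ₀ Pr η Set.univ ≤ 1 := by
  rw [conditionedMeasure, Measure.map_apply (hη.measurable _) MeasurableSet.univ,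
    Set.preimage_univ, cond_apply' MeasurableSet.univ, Set.inter_univ]
  exact ENNReal.inv_mul_le_one _

theorem measurable_comp_nat {Ω X : Type*} [MeasurableSpace Ω] [MeasurableSpace X]
    {g : ℕ → Ω → X} (hg : ∀ k, Measurable (g k)) {u : ℝ → ℕ} (hu : Measurable u) :
    Measurable fun p : ℝ × Ω => g (u p.1) p.2 := by
  have h1 : Measurable fun q : ℕ × Ω => g q.1 q.2 := measurable_from_prod_countable_right hg
  have h2 : Measurable fun p : ℝ × Ω => (u p.1, p.2) :=
    (hu.comp measurable_fst).prodMk measurable_snd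
  exact h1.comp h2

/-- The path is the limit of its values at grid times chosen strictly to the right of `s`, as right
continuity requires. -/
theorem IsProcess.measurable_uncurry (hη : IsProcess Pr η) :
    Measurable fun p : ℝ × Ω => η p.1.toNNReal p.2 := by
  obtain ⟨u, hu⟩ : ∃ u : ℕ → ℝ → ℕ, ∀ n s, u n s = ⌊s.toNNReal * (n + 1)⌋₊ :=
    ⟨fun n s => ⌊s.toNNReal * (n + 1)⌋₊, fun _ _ => rfl⟩
  have hlim : ∀ s : ℝ, Tendsto (fun n : ℕ => ((u n s : ℝ≥0) + 1) / (n + 1)) atTop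
      (𝓝[>] s.toNNReal) := by
    intro s
    have hpos : ∀ n : ℕ, (0 : ℝ≥0) < n + 1 := fun n => by positivity
    have h1 : ∀ n : ℕ, s.toNNReal < ((u n s : ℝ≥0) + 1) / (n + 1) := by
      intro n
      rw [lt_div_iff₀ (hpos n), hu]
      exact Nat.lt_floor_add_one _
    have h2 : ∀ n : ℕ, ((u n s : ℝ≥0) + 1) / (n + 1) ≤ s.toNNReal + 1 / (n + 1) := by
      intro n
      rw [add_div]
      gcongr
      rw [div_le_iff₀ (hpos n), hu]
      exact Nat.floor_le (by positivity)
    refine tendsto_nhdsWithin_iff.2 ⟨?_, Eventually.of_forall h1⟩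
    have h3 : Tendsto (fun n : ℕ => s.toNNReal + 1 / ((n : ℝ≥0) + 1)) atTop (𝓝 s.toNNReal) := by
      have := (tendsto_one_div_add_atTop_nhds_zero_nat (𝕜 := ℝ≥0)).const_add s.toNNReal
      simpa using this
    exact tendsto_of_tendsto_of_tendsto_of_le_of_le tendsto_const_nhds h3 (fun n => (h1 n).le) h2
  have hmeas : ∀ n : ℕ, Measurable fun p : ℝ × Ω =>
      η (((u n p.1 : ℝ≥0) + 1) / (n + 1)) p.2 := by
    intro n
    have h2 : Measurable (u n) := by
      rw [show u n = fun s => ⌊s.toNNReal * ((n : ℝ≥0) + 1)⌋₊ from funext (hu n)]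
      exact Nat.measurable_floor.comp (measurable_real_toNNReal.mul_const _)
    exact measurable_comp_nat (fun k : ℕ => hη.measurable (((k : ℝ≥0) + 1) / (n + 1))) h2
  refine measurable_of_tendsto_metrizable hmeas (tendsto_pi_nhds.2 fun p => ?_)
  exact tendsto_nhds_of_eventually_eq ((hlim p.1).eventually (hη.right_continuous p.2 _))

/-- The time integral of an observable, in terms of the transition matrices. -/
theorem IsProcess.lintegral_lintegral_eq (hη : IsProcess Pr η) (a : Config N)
    {W : Config N → ℝ} (hW : ∀ b, 0 ≤ W b) (T : ℝ) :
    ∫⁻ ω, (∫⁻ s in Set.Icc (0 : ℝ) T, ENNReal.ofReal (W (η s.toNNReal ω))) ∂(Pr a) =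
      ∫⁻ s in Set.Icc (0 : ℝ) T, ENNReal.ofReal (∑ b, transition N s a b * W b) := by
  have := hη.isProbabilityMeasure a
  have hWm : Measurable fun b : Config N => ENNReal.ofReal (W b) := measurable_of_finite _
  have hm : Measurable fun p : ℝ × Ω => ENNReal.ofReal (W (η p.1.toNNReal p.2)) :=
    hWm.comp hη.measurable_uncurry
  have hm' : AEMeasurable (Function.uncurry fun (ω : Ω) (s : ℝ) =>
      ENNReal.ofReal (W (η s.toNNReal ω))) ((Pr a).prod (volume.restrict (Set.Icc 0 T))) :=
    (hm.comp measurable_swap).aemeasurable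
  rw [lintegral_lintegral_swap hm']
  refine setLIntegral_congr_fun measurableSet_Icc fun s hs => ?_
  change ∫⁻ ω, ENNReal.ofReal (W (η s.toNNReal ω)) ∂(Pr a) = _
  rw [← lintegral_map (f := fun b : Config N => ENNReal.ofReal (W b)) hWm (hη.measurable _),
    lintegral_fintype, ENNReal.ofReal_sum_of_nonneg
      (fun b _ => mul_nonneg (hη.transition_nonneg a b hs.1) (hW b))]
  refine Finset.sum_congr rfl fun b _ => ?_
  rw [Measure.map_apply (hη.measurable _) (measurableSet_singleton b),
    ENNReal.ofReal_mul (hη.transition_nonneg a b hs.1), mul_comm]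
  congr 1
  have := hη.prob_eq a b s.toNNReal
  rw [Real.coe_toNNReal _ hs.1] at this
  exact this

/-- The replacement estimate for a process started from a configuration without neighbouring
holes. -/
theorem IsProcess.lintegral_V_le (hη : IsProcess Pr η) {k : ℕ} (hk : 1 ≤ k) (hN : 4 * k + 6 ≤ N)
    {r : ℝ} (hr : 0 < r) {T : ℝ} (hT : 0 ≤ T) {a : Config N} (ha : Isolated a) :
    ∫⁻ ω, (∫⁻ s in Set.Icc (0 : ℝ) T, ENNReal.ofReal (1 / (N : ℝ) * ∑ x : ZMod N,
      |V k (shift x (η s.toNNReal ω))|)) ∂(Pr a) ≤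
      ENNReal.ofReal (2 * r * ((2 * k + 1 : ℕ) : ℝ) / N * (4 + 2 * T) +
        (2 / r + (14 * r + 37) / ((2 * k + 1 : ℕ) : ℝ)) * T) := by
  set A : ℝ := 2 * r * ((2 * k + 1 : ℕ) : ℝ) / N with hA
  set B : ℝ := 2 / r + (14 * r + 37) / ((2 * k + 1 : ℕ) : ℝ) with hB
  have hA0 : 0 ≤ A := by positivity
  have hB0 : 0 ≤ B := by positivity
  have hpos : ∀ t, 0 ≤ t → ∀ b, 0 ≤ transition N t a b := fun t ht b =>
    hη.transition_nonneg a b ht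
  rw [hη.lintegral_lintegral_eq a
    (W := fun b => 1 / (N : ℝ) * ∑ x : ZMod N, |V k (shift x b)|) (fun b => by positivity) T]
  have hcont : Continuous fun s => A * bondVariation (transition N s a) + B :=
    (continuous_const.mul (continuous_bondVariation a)).add continuous_const
  calc ∫⁻ s in Set.Icc (0 : ℝ) T, ENNReal.ofReal
        (∑ b, transition N s a b * (1 / (N : ℝ) * ∑ x : ZMod N, |V k (shift x b)|))
      ≤ ∫⁻ s in Set.Icc (0 : ℝ) T,
          ENNReal.ofReal (A * bondVariation (transition N s a) + B) := by
        refine setLIntegral_mono_ae' measurableSet_Icc (Eventually.of_forall fun s hs => ?_)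
        refine ENNReal.ofReal_le_ofReal ?_
        have := sum_mul_V_le hk hN (f := transition N s a) (hpos s hs.1)
          (fun b hb => transition_eq_zero (by omega) s ha hb) (sum_transition a s).le hr
        rw [hA, hB]
        linarith
    _ = ENNReal.ofReal (∫ s in Set.Icc (0 : ℝ) T,
          (A * bondVariation (transition N s a) + B)) := by
        rw [ofReal_integral_eq_lintegral_ofReal (hcont.integrableOn_Icc)]
        exact Eventually.of_forall fun s => add_nonneg (mul_nonneg hA0 (bondVariation_nonneg _)) hB0
    _ ≤ _ := by
        refine ENNReal.ofReal_le_ofReal ?_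
        have hsplit : ∫ s in (0 : ℝ)..T, (A * bondVariation (transition N s a) + B) =
            (∫ s in (0 : ℝ)..T, A * bondVariation (transition N s a)) + ∫ _ in (0 : ℝ)..T, B :=
          intervalIntegral.integral_add
            ((continuous_const.mul (continuous_bondVariation a)).intervalIntegrable _ _) (by simp)
        rw [integral_Icc_eq_integral_Ioc, ← intervalIntegral.integral_of_le hT, hsplit,
          intervalIntegral.integral_const_mul]
        simp only [intervalIntegral.integral_const, sub_zero, smul_eq_mul]
        rw [mul_comm T B]
        gcongr
        exact integral_bondVariation_le (by omega) ha hpos hT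

theorem lintegral_startedFrom_le {ν : Measure (Config N)} (hν : ∀ c, ¬ Isolated c → ν {c} = 0)
    (hν1 : ν Set.univ ≤ 1) {G : Ω → ℝ≥0∞} {C : ℝ≥0∞}
    (hG : ∀ a, Isolated a → ∫⁻ ω, G ω ∂(Pr a) ≤ C) :
    ∫⁻ ω, G ω ∂(startedFrom Pr ν) ≤ C := by
  rw [startedFrom, lintegral_finsetSum_measure]
  calc ∑ a, ∫⁻ ω, G ω ∂(ν {a} • Pr a) ≤ ∑ a, C * ν {a} := by
        refine Finset.sum_le_sum fun a _ => ?_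
        rw [lintegral_smul_measure, smul_eq_mul, mul_comm]
        by_cases ha : Isolated a
        · gcongr; exact hG a ha
        · simp [hν a ha]
    _ = C * ν Set.univ := by rw [← lintegral_fintype, lintegral_const]
    _ ≤ C := mul_le_of_le_one_right' hν1

end Trajectories

/-! ### Choice of scales and conclusion. -/

/-- The choice of the parameters in the replacement estimate. -/
theorem replacement_bound {ε T : ℝ} (hε : 0 < ε) (hε1 : ε ≤ 1 / 16) (hT : 0 ≤ T) {N : ℕ}
    (hN : 1 / ε ^ 2 ≤ N) :
    1 ≤ ⌊ε * (N : ℝ)⌋₊ ∧ 4 * ⌊ε * (N : ℝ)⌋₊ + 6 ≤ N ∧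
    2 * (1 / √ε) * ((2 * ⌊ε * (N : ℝ)⌋₊ + 1 : ℕ) : ℝ) / N * (4 + 2 * T) +
      (2 / (1 / √ε) + (14 * (1 / √ε) + 37) / ((2 * ⌊ε * (N : ℝ)⌋₊ + 1 : ℕ) : ℝ)) * T ≤
        √ε * (24 + 65 * T) := by
  set k := ⌊ε * (N : ℝ)⌋₊ with hk
  set q := √ε with hq
  have hq0 : 0 < q := Real.sqrt_pos.2 hε
  have hqq : q * q = ε := Real.mul_self_sqrt hε.le
  have hq1 : q ≤ 1 := by nlinarith
  have hεN : 1 / ε ≤ ε * N := by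
    have : ε * (1 / ε ^ 2) = 1 / ε := by field_simp
    rw [← this]; gcongr
  have hinv : 16 ≤ 1 / ε := by rw [le_div_iff₀ hε]; linarith
  have hN0 : (0 : ℝ) < N := lt_of_lt_of_le (by positivity) hN
  have hk1 : (k : ℝ) ≤ ε * N := Nat.floor_le (by positivity)
  have hk2 : ε * N < k + 1 := Nat.lt_floor_add_one _
  have hN8 : ε * N ≤ N / 16 := by nlinarith
  refine ⟨?_, ?_, ?_⟩
  · have : (1 : ℝ) < (k : ℝ) + 1 := by linarith
    have : 0 < k := by exact_mod_cast (by linarith : (0 : ℝ) < k)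
    omega
  · have : (4 * (k : ℝ) + 6) ≤ N := by linarith
    exact_mod_cast this
  · push_cast
    set n : ℝ := 2 * (k : ℝ) + 1 with hn
    have hn1 : n ≤ 3 * ε * N := by linarith
    -- The lower bound on `N` is made for this: the error terms in 1/n become at most of order ε,
    -- which absorbs the factor 1/√ε in front of them.
    have hn2 : 1 / ε ≤ n := by linarith
    have hn0 : 0 < n := lt_of_lt_of_le (by positivity) hn2
    have hn3 : 1 / n ≤ ε := by
      rw [div_le_iff₀ hn0]
      have := mul_le_mul_of_nonneg_left hn2 hε.le
      rwa [mul_one_div_cancel hε.ne'] at this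
    have h1 : 2 * (1 / q) * n / N ≤ 6 * q := by
      rw [div_le_iff₀ hN0]
      calc 2 * (1 / q) * n ≤ 2 * (1 / q) * (3 * (q * q) * N) := by rw [hqq]; gcongr
        _ = 6 * q * N := by field_simp; ring
    have h2 : 2 / (1 / q) = 2 * q := by field_simp
    have h3 : (14 * (1 / q) + 37) / n ≤ 51 * q := by
      calc (14 * (1 / q) + 37) / n = (14 * (1 / q) + 37) * (1 / n) := by ring
        _ ≤ (14 * (1 / q) + 37) * (q * q) := by rw [hqq]; gcongr
        _ = 14 * q + 37 * (q * q) := by field_simp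
        _ ≤ 51 * q := by nlinarith
    rw [h2]
    calc 2 * (1 / q) * n / N * (4 + 2 * T) + (2 * q + (14 * (1 / q) + 37) / n) * T
        ≤ 6 * q * (4 + 2 * T) + (2 * q + 51 * q) * T := by gcongr
      _ = q * (24 + 65 * T) := by ring

end FEP

theorem lemma5p4 {Ω : ℕ+ → Type*} [∀ N, MeasurableSpace (Ω N)]
    (Pr : ∀ N : ℕ+, FEP.Config N → Measure (Ω N))
    (η : ∀ N : ℕ+, ℝ≥0 → Ω N → FEP.Config N)
    (hη : ∀ N : ℕ+, FEP.IsProcess (Pr N) (η N))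
    (ρ₀ : ℝ → ℝ) (hsmooth : ContDiff ℝ (⊤ : ℕ∞) ρ₀) (hper : Function.Periodic ρ₀ 1)
    (hρ₀ : ∀ u, ρ₀ u ∈ Set.Ioc (1 / 2 : ℝ) 1) (T : ℝ) (hT : 0 < T) :
    limsup (fun ε : ℝ =>
      limsup (fun N : ℕ+ =>
        ∫⁻ ω, (∫⁻ s in Set.Icc (0 : ℝ) T,
          ENNReal.ofReal (1 / (N : ℝ) * ∑ x : ZMod N,
            |FEP.V ⌊ε * (N : ℝ)⌋₊ (FEP.shift x (η N s.toNNReal ω))|))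
          ∂(FEP.startedFrom (Pr N) (FEP.conditionedMeasure ρ₀ (Pr N) (η N))))
        atTop)
      (𝓝[>] 0) = 0 := by
  have hbound : ∀ᶠ ε : ℝ in 𝓝[>] 0,
      limsup (fun N : ℕ+ =>
        ∫⁻ ω, (∫⁻ s in Set.Icc (0 : ℝ) T,
          ENNReal.ofReal (1 / (N : ℝ) * ∑ x : ZMod N,
            |FEP.V ⌊ε * (N : ℝ)⌋₊ (FEP.shift x (η N s.toNNReal ω))|))
          ∂(FEP.startedFrom (Pr N) (FEP.conditionedMeasure ρ₀ (Pr N) (η N))))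
        atTop ≤ ENNReal.ofReal (√ε * (24 + 65 * T)) := by
    -- For these ε, and `N` at least 1/ε², the box is nonempty on both sides of its centre and short
    -- enough for its particles to be followed without going round the torus.
    filter_upwards [Ioc_mem_nhdsGT (by norm_num : (0 : ℝ) < 1 / 16)] with ε hε
    refine limsup_le_of_le (by isBoundedDefault) ?_
    obtain ⟨M, hM⟩ := exists_nat_ge (1 / ε ^ 2)
    filter_upwards [eventually_ge_atTop (⟨M + 1, M.succ_pos⟩ : ℕ+)] with N hN
    have hMN : M + 1 ≤ (N : ℕ) := hN
    have hN' : 1 / ε ^ 2 ≤ ((N : ℕ) : ℝ) :=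
      hM.trans (by exact_mod_cast (Nat.le_succ M).trans hMN)
    obtain ⟨h1, h2, h3⟩ := FEP.replacement_bound hε.1 hε.2 hT.le hN'
    refine FEP.lintegral_startedFrom_le
      (fun c hc => FEP.conditionedMeasure_singleton (by omega) (hη N) ρ₀ hc)
      (FEP.conditionedMeasure_univ_le (hη N) ρ₀) fun a ha => ?_
    exact ((hη N).lintegral_V_le h1 h2 (r := 1 / √ε)
      (one_div_pos.2 (Real.sqrt_pos.2 hε.1)) hT.le ha).trans (ENNReal.ofReal_le_ofReal h3)
  have hlim : Tendsto (fun ε : ℝ => ENNReal.ofReal (√ε * (24 + 65 * T))) (𝓝[>] 0) (𝓝 0) := by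
    have h1 : Continuous fun ε : ℝ => ENNReal.ofReal (√ε * (24 + 65 * T)) :=
      ENNReal.continuous_ofReal.comp (Real.continuous_sqrt.mul continuous_const)
    have h2 := h1.tendsto 0
    simp only [Real.sqrt_zero, zero_mul, ENNReal.ofReal_zero] at h2
    exact h2.mono_left nhdsWithin_le_nhds
  refine le_antisymm ?_ bot_le
  calc _ ≤ limsup (fun ε : ℝ => ENNReal.ofReal (√ε * (24 + 65 * T))) (𝓝[>] 0) :=
        limsup_le_limsup hbound
    _ = 0 := hlim.limsup_eq
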